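/- Identify $\mathbb R^3$ with $\mathbb C\times\mathbb R$ by $(x_1+ix_2,x_3)$. Let $\mathbb L_3$ be $\mathbb R^3$ with the metric $dx_1^2+dx_2^2-dx_3^2$, and let ${\rm Nil}_3$ be $\mathbb R^3$ with the metric $dx_1^2+dx_2^2+\{dx_3+\frac12(x_2dx_1-x_1dx_2)\}^2$ and the group law $a\cdot x=(a_1+x_1,\,a_2+x_2,\,a_3+x_3+\frac12(a_1x_2-a_2x_1))$; a translation of ${\rm Nil}_3$ is a map $x\mapsto a\cdot x$. An isometry of ${\rm Nil}_3$ is a smooth bijection preserving its metric. Identify $\mathfrak{su}_{1,1}$ with $\mathbb R^3$ through the basis $$\mathcal E_1=\tfrac12\begin{pmatrix}0&i\\-i&0\end{pmatrix},\quad \mathcal E_2=\tfrac12\begin{pmatrix}0&-1\\-1&0\end{pmatrix},\quad \mathcal E_3=\tfrac12\begin{pmatrix}-i&0\\0&i\end{pmatrix}.$$ Let $U\subset\mathbb C$ be a nonempty connected open set. An extended frame on $U$ is a family of maps $F^\lambda:U\to{\rm SU}_{1,1}$, $\lambda\in\mathbb S^1$, smooth in $(\lambda,z)$, with $F^{-\lambda}=\sigma_3F^\lambda\sigma_3$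 where $\sigma_3={\rm diag}(1,-1)$, such that for some smooth $h:U\to(0,\infty)$ and some holomorphic $B$ on $U$, with $e^{w/2}=\frac i4h$ (so $w_z=2h_z/h$, $w_{\bar z}=2h_{\bar z}/h$), $$(F^\lambda)^{-1}dF^\lambda=\begin{pmatrix}\frac14w_z&-\lambda^{-1}e^{w/2}\\ \lambda^{-1}Be^{-w/2}&-\frac14w_z\end{pmatrix}dz+\begin{pmatrix}-\frac14w_{\bar z}&-\lambda\bar Be^{-w/2}\\ \lambda e^{w/2}&\frac14w_{\bar z}\end{pmatrix}d\bar z\qquad(\lambda\in\mathbb S^1).$$ It defines the spacelike surfaces of constant mean curvature $1/2$ in $\mathbb L_3$ $$f^\lambda_{\mathbb L_3}=-i\lambda(\partial_\lambda F^\lambda)(F^\lambda)^{-1}-\tfrac i2{\rm Ad}(F^\lambda)\sigma_3\in\mathfrak{su}_{1,1}\cong\mathbb L_3$$ and the minimal surfaces $f^\lambda$ in ${\rm Nil}_3$ whose coordinates $(x_1,x_2,x_3)$ are those of $(f^\lambda_{\mathbb L_3})^{o}-\frac i2\lambda(\partial_\lambda f^\lambda_{\mathbb L_3})^{d}\in\mathfrak{su}_{1,1}$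 with respect to the above basis, where $o$ and $d$ denote the off-diagonal and the diagonal part and $i\lambda\partial_\lambda=\partial_\theta$ for $\lambda=e^{i\theta}$. Write $f_{\mathbb L_3}$, $f$ for the members $\lambda=1$. Let $F^\lambda$, $\tilde F^\lambda$ be extended frames on $U$, with corresponding surfaces $f_{\mathbb L_3},f$ and $\tilde f_{\mathbb L_3},\tilde f$ (all maps defined on $U$). 1. If $\tilde f_{\mathbb L_3}=R_\varphi\circ f_{\mathbb L_3}$, where $R_\varphi$ is the rotation $(\zeta,x_3)\mapsto(e^{i\varphi}\zeta,x_3)$ about the timelike $x_3$-axis, then there is $a\in{\rm Nil}_3$ with $\tilde f=a\cdot(R_\varphi\circ f)$. 2. If $\tilde f_{\mathbb L_3}=f_{\mathbb L_3}+b$ for some $b\in\mathbb R^3$, then there is $a\in{\rm Nil}_3$ with $\tilde f=a\cdot f$. 3. For $\varphi,t\in\mathbb R$ with $t\neq0$, let $L_{\varphi,t}$ be the boost of rapidity $t$ in the direction $(\cos\varphi,\sin\varphi,0)$: if $s$ is the coordinate along this direction, $L_{\varphi,t}$ maps $(s,x_3)$ to $(s\cosh t+x_3\sinh t,\ s\sinh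 t+x_3\cosh t)$ and fixes the orthogonal horizontal coordinate. If $\tilde f_{\mathbb L_3}=L_{\varphi,t}\circ f_{\mathbb L_3}$, then there is no isometry $g$ of ${\rm Nil}_3$ with $\tilde f=g\circ f$. In general the images are not congruent either: for every $\varphi\in\mathbb R$, every $t\neq0$ and every $U$ as above there are extended frames $F^\lambda,\tilde F^\lambda$ on $U$ with $\tilde f_{\mathbb L_3}=L_{\varphi,t}\circ f_{\mathbb L_3}$ such that no isometry $g$ of ${\rm Nil}_3$ satisfies $g(f(U))=\tilde f(U)$. -/

import Mathlib

open Matrix Set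
open scoped ContDiff ComplexConjugate

noncomputable section

/-! ### Coordinate space, Minkowski space and its rigid motions

Both Minkowski space `𝕃₃` (metric `dx₁² + dx₂² - dx₃²`) and the Heisenberg group `Nil₃` are modelled
on `ℂ × ℝ`, the point `(x₁, x₂, x₃)` being `(x₁ + i x₂, x₃)`. -/

/-- Rotation by the angle `φ` about the `x₃`-axis (an isometry of `𝕃₃` and of `Nil₃`). -/
def axisRotation (φ : ℝ) (p : ℂ × ℝ) : ℂ × ℝ :=
  (Complex.exp (φ * Complex.I) * p.1, p.2)

/-- The boost of `𝕃₃` of rapidity `t` in the horizontal direction `u = e^{iφ}`: it acts as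
`(s, x₃) ↦ (s cosh t + x₃ sinh t, s sinh t + x₃ cosh t)` on the plane spanned by `u` and the
`x₃`-axis, where `s` is the coordinate along `u`, and fixes the horizontal direction
orthogonal to `u`. -/
def lorentzBoost (φ t : ℝ) (p : ℂ × ℝ) : ℂ × ℝ :=
  let u : ℂ := Complex.exp (φ * Complex.I)
  let s : ℝ := (conj u * p.1).re
  (p.1 + (((Real.cosh t - 1) * s + Real.sinh t * p.2 : ℝ) : ℂ) * u,
    Real.sinh t * s + Real.cosh t * p.2)

/-! ### The Heisenberg group -/

/-- The group multiplication of `Nil₃`: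
`a · x = (a₁ + x₁, a₂ + x₂, a₃ + x₃ + (a₁ x₂ - a₂ x₁) / 2)`. The map `nilMul a` is the
(left) translation by `a`. -/
def nilMul (a p : ℂ × ℝ) : ℂ × ℝ :=
  (a.1 + p.1, a.2 + p.2 + (a.1.re * p.1.im - a.1.im * p.1.re) / 2)

/-- The contact form `dx₃ + (x₂ dx₁ - x₁ dx₂) / 2` of `Nil₃` at `p`, on the tangent vector `v`. -/
def nilForm (p v : ℂ × ℝ) : ℝ :=
  v.2 + (p.1.im * v.1.re - p.1.re * v.1.im) / 2

/-- The Riemannian metric `dx₁² + dx₂² + (dx₃ + (x₂ dx₁ - x₁ dx₂) / 2)²` of `Nil₃` at `p`. -/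
def nilMetric (p v w : ℂ × ℝ) : ℝ :=
  v.1.re * w.1.re + v.1.im * w.1.im + nilForm p v * nilForm p w

/-- Isometries of the Riemannian manifold `Nil₃`: smooth bijections preserving the metric. -/
structure IsNilIsometry (g : ℂ × ℝ → ℂ × ℝ) : Prop where
  bijective : Function.Bijective g
  smooth : ContDiff ℝ ∞ g
  metric : ∀ p v w : ℂ × ℝ,
    nilMetric (g p) (fderiv ℝ g p v) (fderiv ℝ g p w) = nilMetric p v w

/-! ### The Lie algebra `𝔰𝔲(1,1)` and its orthonormal basis -/

def pauli₃ : Matrix (Fin 2) (Fin 2) ℂ := !![1, 0; 0, -1]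

/-- Membership in `SU(1,1)`. -/
def IsSU11 (M : Matrix (Fin 2) (Fin 2) ℂ) : Prop :=
  Mᴴ * pauli₃ * M = pauli₃ ∧ M.det = 1

/-- The basis of `𝔰𝔲(1,1)`, orthonormal for the Lorentz form `4 Tr(AB)` up to a constant factor,
with `suBasis 2` timelike. -/
def suBasis : Fin 3 → Matrix (Fin 2) (Fin 2) ℂ :=
  ![(1 / 2 : ℂ) • !![0, Complex.I; -Complex.I, 0],
    (1 / 2 : ℂ) • !![0, -1; -1, 0],
    (1 / 2 : ℂ) • !![-Complex.I, 0; 0, Complex.I]]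

/-- The coordinates `(x₁ + i x₂, x₃)` of an element `x₁ 𝓔₁ + x₂ 𝓔₂ + x₃ 𝓔₃` of `𝔰𝔲(1,1)`. -/
def suCoord (X : Matrix (Fin 2) (Fin 2) ℂ) : ℂ × ℝ :=
  (⟨2 * (X 0 1).im, -2 * (X 0 1).re⟩, -2 * (X 0 0).im)

theorem suCoord_basis (x₁ x₂ x₃ : ℝ) :
    suCoord ((x₁ : ℂ) • suBasis 0 + (x₂ : ℂ) • suBasis 1 + (x₃ : ℂ) • suBasis 2) =
      (⟨x₁, x₂⟩, x₃) := by
  simp [suCoord, suBasis]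
  exact ⟨⟨by ring, by ring⟩, by ring⟩

/-! ### Extended frames -/

/-- `∂G/∂z = (G_x - i G_y) / 2`. -/
def wirtinger (G : ℂ → ℂ) (z : ℂ) : ℂ :=
  (fderiv ℝ G z 1 - Complex.I * fderiv ℝ G z Complex.I) / 2

/-- `∂G/∂z̄ = (G_x + i G_y) / 2`. -/
def wirtingerBar (G : ℂ → ℂ) (z : ℂ) : ℂ :=
  (fderiv ℝ G z 1 + Complex.I * fderiv ℝ G z Complex.I) / 2

/-- The `dz`-part of the Maurer-Cartan form `α^λ` (for vanishing mean curvature in `Nil₃`),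
with `e^{w/2} = i h / 4`, so that `w_z = 2 h_z / h`. -/
def frameU (h : ℂ → ℝ) (B : ℂ → ℂ) (l : Circle) (z : ℂ) : Matrix (Fin 2) (Fin 2) ℂ :=
  let D : ℂ := Complex.I / 4 * h z
  let w_z : ℂ := 2 * wirtinger (fun ζ => (h ζ : ℂ)) z / h z
  !![w_z / 4, -(l : ℂ)⁻¹ * D;
     (l : ℂ)⁻¹ * B z / D, -w_z / 4]

/-- The `dz̄`-part of the Maurer-Cartan form `α^λ`. -/
def frameV (h : ℂ → ℝ) (B : ℂ → ℂ) (l : Circle) (z : ℂ) : Matrix (Fin 2) (Fin 2) ℂ :=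
  let D : ℂ := Complex.I / 4 * h z
  let w_zbar : ℂ := 2 * wirtingerBar (fun ζ => (h ζ : ℂ)) z / h z
  !![-w_zbar / 4, -(l : ℂ) * conj (B z) / D;
     (l : ℂ) * D, w_zbar / 4]

/-- `F` is an extended frame on the domain `U`: a smooth map `(λ, z) ↦ F λ z` on `S¹ × U` with
values in `SU(1,1)`, twisted in the loop variable `λ` (`F^{-λ} = σ₃ F^λ σ₃`), solving
`(F^λ)⁻¹ dF^λ = α^λ` for all `λ`, for some positive function `h` (the support) and some
holomorphic `B` (`4 B dz²` being the Abresch-Rosenberg differential). -/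
structure IsExtendedFrame (U : Set ℂ) (F : Circle → ℂ → Matrix (Fin 2) (Fin 2) ℂ) : Prop where
  smooth : ∀ i j, ContDiffOn ℝ ∞
    (fun p : ℝ × ℂ => F (Circle.exp p.1) p.2 i j) (univ ×ˢ U)
  mem_SU11 : ∀ l, ∀ z ∈ U, IsSU11 (F l z)
  twisted : ∀ l, ∀ z ∈ U, F (Circle.exp Real.pi * l) z = pauli₃ * F l z * pauli₃
  maurerCartan : ∃ (h : ℂ → ℝ) (B : ℂ → ℂ),
    ContDiffOn ℝ ∞ h U ∧ (∀ z ∈ U, 0 < h z) ∧ DifferentiableOn ℂ B U ∧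
    ∀ l, ∀ z ∈ U,
      Matrix.of (fun i j => wirtinger (fun ζ => F l ζ i j) z) = F l z * frameU h B l z ∧
      Matrix.of (fun i j => wirtingerBar (fun ζ => F l ζ i j) z) = F l z * frameV h B l z

/-! ### The Sym formulas -/

/-- The derivative `i λ ∂_λ = ∂_θ` (`λ = e^{iθ}`) of a matrix-valued function on the circle. -/
def loopDeriv (G : Circle → Matrix (Fin 2) (Fin 2) ℂ) (l : Circle) :
    Matrix (Fin 2) (Fin 2) ℂ :=
  Matrix.of fun i j => deriv (fun t : ℝ => G (Circle.exp t * l) i j) 0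

/-- `N_{𝕃₃}^λ = (i/2) Ad(F^λ) σ₃`. -/
def symNormal (F : Circle → ℂ → Matrix (Fin 2) (Fin 2) ℂ) (l : Circle) (z : ℂ) :
    Matrix (Fin 2) (Fin 2) ℂ :=
  (Complex.I / 2) • (F l z * pauli₃ * (F l z)⁻¹)

/-- `f_{𝕃₃}^λ = -i λ (∂_λ F^λ) (F^λ)⁻¹ - N_{𝕃₃}^λ`, as a map into `𝔰𝔲(1,1)`. -/
def symMatrix (F : Circle → ℂ → Matrix (Fin 2) (Fin 2) ℂ) (l : Circle) (z : ℂ) :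
    Matrix (Fin 2) (Fin 2) ℂ :=
  -(loopDeriv (fun m => F m z) l * (F l z)⁻¹) - symNormal F l z

/-- The off-diagonal part of `f_{𝕃₃}^λ` plus the diagonal part of
`-(i/2) λ ∂_λ f_{𝕃₃}^λ`. -/
def symNilMatrix (F : Circle → ℂ → Matrix (Fin 2) (Fin 2) ℂ) (l : Circle) (z : ℂ) :
    Matrix (Fin 2) (Fin 2) ℂ :=
  Matrix.of fun i j =>
    if i = j then -(1 / 2) * loopDeriv (fun m => symMatrix F m z) l i j
    else symMatrix F l z i j

/-- The spacelike surface `f_{𝕃₃}^λ` in `𝕃₃`, of constant mean curvature `1/2`, given by the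
extended frame `F`. -/
def cmcSurface (F : Circle → ℂ → Matrix (Fin 2) (Fin 2) ℂ) (l : Circle) (z : ℂ) : ℂ × ℝ :=
  suCoord (symMatrix F l z)

/-- The minimal surface `f^λ` in `Nil₃` given by the extended frame `F`. (In the coordinates
used here the exponential map of `Nil₃` is the identity of `ℂ × ℝ`.) -/
def nilSurface (F : Circle → ℂ → Matrix (Fin 2) (Fin 2) ℂ) (l : Circle) (z : ℂ) : ℂ × ℝ :=
  suCoord (symNilMatrix F l z)

end

/-! Write (ζ, x₃) for the coordinates of the surface in 𝕃₃. Derivatives in θ and z commute, so the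
Sym formulas can be differentiated explicitly. The surface in Nil₃ has the same horizontal part ζ,
and its height y satisfies dy(v) = ½ Im(ζ̄ dζ(v)) + dx₃(iv)
(`IsExtendedFrame.fderiv_nilSurface_snd`). Hence the surface in 𝕃₃ determines the one in Nil₃ up to
a vertical translation. A rotation leaves the right-hand side unchanged. A translation by b adds ½
Im(b̄ dζ), which is what a left translation of Nil₃ over b adds to dy.

For boosts, every isometry of Nil₃ is affine and fibered over an affine map of the plane
(`IsNilIsometry.exists_affine`). This comes from `IsNilCoframe.rigid`: the matrix O of the
differential in the left-invariant frame has derivatives expressed algebraically in O by a Koszul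
formula, and the bracket [X₁, X₂] = X₃ applied to its third row forces the vertical direction to be
preserved; the torsion then vanishes and O is constant. A congruence would therefore make the
boosted ζ affine in the old ζ. Its component along the boost is s cosh t + x₃ sinh t, so x₃ would be
affine in ζ. This is excluded by `IsExtendedFrame.not_planar`: planarity is a quadratic equation on
the first column of the frame, differentiation puts that column in the kernel of the quadratic form,
and the SU(1,1) symmetry then makes the determinant vanish.

For images, the examples are hyperbolic cylinders, with x + iy = e^{-iφ}z. For t = 0 the height in
Nil₃ is a quadratic polynomial in ζ, a property kept by affine fibered bijections. For t ≠ 0 it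
contains the term 2x sinh t, which no quadratic polynomial in ζ can match (`not_forall_quadratic`).
-/

/-! ### Calculus on ℝ × ℂ: commuting partial derivatives and slices -/

theorem fderiv_fderiv_apply_comm {E F : Type*} [NormedAddCommGroup E] [NormedSpace ℝ E]
    [NormedAddCommGroup F] [NormedSpace ℝ F] {f : E → F} {p : E} (hf : ContDiffAt ℝ ∞ f p)
    (v w : E) :
    fderiv ℝ (fun q => fderiv ℝ f q v) p w = fderiv ℝ (fun q => fderiv ℝ f q w) p v := by
  have hd : DifferentiableAt ℝ (fderiv ℝ f) p :=
    (hf.fderiv_right (m := 1) (by norm_cast)).differentiableAt one_ne_zero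
  have h (v : E) : HasFDerivAt (fun q => fderiv ℝ f q v)
      ((ContinuousLinearMap.apply ℝ F v).comp (fderiv ℝ (fderiv ℝ f) p)) p :=
    (ContinuousLinearMap.apply ℝ F v).hasFDerivAt.comp p hd.hasFDerivAt
  rw [(h v).fderiv, (h w).fderiv]
  exact (hf.isSymmSndFDerivAt (by simp; norm_cast)).eq w v

theorem contDiffAt_fderiv_apply {E F : Type*} [NormedAddCommGroup E] [NormedSpace ℝ E]
    [NormedAddCommGroup F] [NormedSpace ℝ F] {f : E → F} {p : E} (hf : ContDiffAt ℝ ∞ f p)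
    (v : E) : ContDiffAt ℝ ∞ (fun q => fderiv ℝ f q v) p :=
  (hf.fderiv_right (m := ∞) (by norm_cast)).clm_apply contDiffAt_const

theorem hasDerivAt_fst_slice {f : ℝ × ℂ → ℂ} {s : ℝ} {z : ℂ} (hf : DifferentiableAt ℝ f (s, z)) :
    HasDerivAt (fun r => f (r, z)) (fderiv ℝ f (s, z) (1, 0)) s := by
  have h : HasDerivAt (fun r : ℝ => (r, z)) ((1 : ℝ), (0 : ℂ)) s :=
    (hasDerivAt_id s).prodMk (hasDerivAt_const s z)
  exact hf.hasFDerivAt.comp_hasDerivAt s h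

theorem hasFDerivAt_snd_slice {f : ℝ × ℂ → ℂ} {s : ℝ} {z : ℂ}
    (hf : DifferentiableAt ℝ f (s, z)) :
    HasFDerivAt (fun ζ => f (s, ζ)) ((fderiv ℝ f (s, z)).comp (ContinuousLinearMap.inr ℝ ℝ ℂ)) z :=
  hf.hasFDerivAt.comp z (hasFDerivAt_prodMk_right s z)

/-! ### Differentiating the Sym formulas along the surface -/

/-- The entries of the Maurer-Cartan form at a point, as functions of the loop parameter. -/
structure IsLoopPrimitive (a b : ℝ × ℂ → ℂ) (h : ℝ) (Q R : ℂ) (κ : ℂ → ℂ) (z : ℂ) : Prop where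
  smooth_left : ∀ s, ContDiffAt ℝ ∞ a (s, z)
  smooth_right : ∀ s, ContDiffAt ℝ ∞ b (s, z)
  deriv_left : ∀ (s : ℝ) (v : ℂ), fderiv ℝ a (s, z) (0, v) = a (s, z) * κ v +
    b (s, z) * (Complex.exp (-(s * Complex.I)) * R * v +
      Complex.exp (s * Complex.I) * (Complex.I / 4 * h) * conj v)
  deriv_right : ∀ (s : ℝ) (v : ℂ), fderiv ℝ b (s, z) (0, v) =
    a (s, z) * (-Complex.exp (-(s * Complex.I)) * (Complex.I / 4 * h) * v -
      Complex.exp (s * Complex.I) * Q * conj v) - b (s, z) * κ v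

theorem hasDerivAt_exp_mul_I (s : ℝ) :
    HasDerivAt (fun r : ℝ => Complex.exp (r * Complex.I)) (Complex.exp (s * Complex.I) * Complex.I)
      s := by
  have := ((hasDerivAt_id (s : ℂ)).mul_const Complex.I).cexp.comp_ofReal
  simpa using this

theorem hasDerivAt_exp_neg_mul_I (s : ℝ) :
    HasDerivAt (fun r : ℝ => Complex.exp (-(r * Complex.I)))
      (-(Complex.exp (-(s * Complex.I)) * Complex.I)) s := by
  have := ((hasDerivAt_id (s : ℂ)).mul_const Complex.I).neg.cexp.comp_ofReal
  simpa using this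

namespace IsLoopPrimitive

variable {a b c d : ℝ × ℂ → ℂ} {h : ℝ} {Q R : ℂ} {κ : ℂ → ℂ} {z : ℂ}

/-- Exchanging the partial derivatives reduces this to differentiating the linear system in θ, where
besides the frame only the factors e^{±iθ} depend on θ. -/
theorem mixed_left (H : IsLoopPrimitive a b h Q R κ z) (s : ℝ) (v : ℂ) :
    fderiv ℝ (fun q => fderiv ℝ a q (1, 0)) (s, z) (0, v) =
      fderiv ℝ a (s, z) (1, 0) * κ v + fderiv ℝ b (s, z) (1, 0) *
        (Complex.exp (-(s * Complex.I)) * R * v +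
          Complex.exp (s * Complex.I) * (Complex.I / 4 * h) * conj v) +
      b (s, z) * (-(Complex.exp (-(s * Complex.I)) * Complex.I) * R * v +
          Complex.exp (s * Complex.I) * Complex.I * (Complex.I / 4 * h) * conj v) := by
  rw [fderiv_fderiv_apply_comm (H.smooth_left s)]
  have h1 := hasDerivAt_fst_slice
    ((contDiffAt_fderiv_apply (H.smooth_left s) (0, v)).differentiableAt (by simp))
  have ha := hasDerivAt_fst_slice ((H.smooth_left s).differentiableAt (by simp))
  have hb := hasDerivAt_fst_slice ((H.smooth_right s).differentiableAt (by simp))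
  have h2 := (ha.mul_const (κ v)).add (hb.mul
    ((((hasDerivAt_exp_neg_mul_I s).mul_const R).mul_const v).add
      (((hasDerivAt_exp_mul_I s).mul_const (Complex.I / 4 * h)).mul_const (conj v))))
  have h3 : (fun r : ℝ => fderiv ℝ a (r, z) (0, v)) = _ := funext fun r => H.deriv_left r v
  rw [h3] at h1
  have := h1.unique h2
  rw [this]
  simp only [Pi.add_apply]
  ring

theorem mixed_right (H : IsLoopPrimitive a b h Q R κ z) (s : ℝ) (v : ℂ) :
    fderiv ℝ (fun q => fderiv ℝ b q (1, 0)) (s, z) (0, v) =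
      fderiv ℝ a (s, z) (1, 0) * (-Complex.exp (-(s * Complex.I)) * (Complex.I / 4 * h) * v -
          Complex.exp (s * Complex.I) * Q * conj v) - fderiv ℝ b (s, z) (1, 0) * κ v +
      a (s, z) * (Complex.exp (-(s * Complex.I)) * Complex.I * (Complex.I / 4 * h) * v -
          Complex.exp (s * Complex.I) * Complex.I * Q * conj v) := by
  rw [fderiv_fderiv_apply_comm (H.smooth_right s)]
  have h1 := hasDerivAt_fst_slice
    ((contDiffAt_fderiv_apply (H.smooth_right s) (0, v)).differentiableAt (by simp))
  have ha := hasDerivAt_fst_slice ((H.smooth_left s).differentiableAt (by simp))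
  have hb := hasDerivAt_fst_slice ((H.smooth_right s).differentiableAt (by simp))
  have h2 := (ha.mul
    ((((hasDerivAt_exp_neg_mul_I s).neg.mul_const (Complex.I / 4 * h)).mul_const v).sub
      (((hasDerivAt_exp_mul_I s).mul_const Q).mul_const (conj v)))).sub (hb.mul_const (κ v))
  have h3 : (fun r : ℝ => fderiv ℝ b (r, z) (0, v)) = _ := funext fun r => H.deriv_right r v
  rw [h3] at h1
  have := h1.unique h2
  rw [this]
  simp only [Pi.sub_apply, Pi.neg_apply]
  ring

end IsLoopPrimitive

/-- The upper left entry of `-G_θ G⁻¹ - (i/2) G σ₃ G⁻¹` for `G = (a b; c d)` of determinant `1`. -/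
noncomputable def symDiag (a b c d : ℝ × ℂ → ℂ) (p : ℝ × ℂ) : ℂ :=
  -(fderiv ℝ a p (1, 0) * d p - fderiv ℝ b p (1, 0) * c p) -
    Complex.I / 2 * (a p * d p + b p * c p)

/-- The upper right entry of `-G_θ G⁻¹ - (i/2) G σ₃ G⁻¹` for `G = (a b; c d)` of determinant `1`. -/
noncomputable def symOff (a b : ℝ × ℂ → ℂ) (p : ℝ × ℂ) : ℂ :=
  -(fderiv ℝ b p (1, 0) * a p - fderiv ℝ a p (1, 0) * b p) + Complex.I * (a p * b p)

namespace IsLoopPrimitive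

variable {a b c d : ℝ × ℂ → ℂ} {h : ℝ} {Q R : ℂ} {κ : ℂ → ℂ} {z : ℂ}

theorem contDiffAt_symOff (H : IsLoopPrimitive a b h Q R κ z) (s : ℝ) :
    ContDiffAt ℝ ∞ (symOff a b) (s, z) := by
  have ha := H.smooth_left s
  have hb := H.smooth_right s
  have hta := contDiffAt_fderiv_apply ha (1, 0)
  have htb := contDiffAt_fderiv_apply hb (1, 0)
  exact (((htb.mul ha).sub (hta.mul hb)).neg).add (contDiffAt_const.mul (ha.mul hb))

theorem contDiffAt_symDiag (H : IsLoopPrimitive a b h Q R κ z) (K : IsLoopPrimitive c d h Q R κ z)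
    (s : ℝ) : ContDiffAt ℝ ∞ (symDiag a b c d) (s, z) := by
  have ha := H.smooth_left s
  have hb := H.smooth_right s
  have hc := K.smooth_left s
  have hd := K.smooth_right s
  have hta := contDiffAt_fderiv_apply ha (1, 0)
  have htb := contDiffAt_fderiv_apply hb (1, 0)
  exact (((hta.mul hd).sub (htb.mul hc)).neg).sub (contDiffAt_const.mul ((ha.mul hd).add (hb.mul hc)))

/-- The terms containing κ or θ-derivatives of the frame cancel. Of the remaining ones, the normal
term i·ab cancels the contributions of Q and R and doubles those of (i/4)h. Only the metric factor h
survives, so the differential of the surface does not see B. -/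
theorem fderiv_symOff (H : IsLoopPrimitive a b h Q R κ z) (s : ℝ) (v : ℂ) :
    fderiv ℝ (symOff a b) (s, z) (0, v) = h / 2 *
      (a (s, z) ^ 2 * Complex.exp (-(s * Complex.I)) * v -
        b (s, z) ^ 2 * Complex.exp (s * Complex.I) * conj v) := by
  have ha := H.smooth_left s
  have hb := H.smooth_right s
  have hta := ((contDiffAt_fderiv_apply ha (1, 0)).differentiableAt (by simp)).hasFDerivAt
  have htb := ((contDiffAt_fderiv_apply hb (1, 0)).differentiableAt (by simp)).hasFDerivAt
  have ha := (ha.differentiableAt (by simp)).hasFDerivAt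
  have hb := (hb.differentiableAt (by simp)).hasFDerivAt
  have h1 : HasFDerivAt (symOff a b) _ (s, z) :=
    (((htb.mul ha).sub (hta.mul hb)).neg).add ((ha.mul hb).const_mul Complex.I)
  rw [h1.fderiv]
  simp only [_root_.add_apply, _root_.neg_apply,
    _root_.sub_apply, _root_.smul_apply, smul_eq_mul]
  rw [H.mixed_left, H.mixed_right, H.deriv_left, H.deriv_right]
  linear_combination (-(h : ℂ) / 2 * (a (s, z) ^ 2 * Complex.exp (-(s * Complex.I)) * v -
        b (s, z) ^ 2 * Complex.exp (s * Complex.I) * conj v)) * Complex.I_sq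

theorem fderiv_symDiag (H : IsLoopPrimitive a b h Q R κ z) (K : IsLoopPrimitive c d h Q R κ z)
    (s : ℝ) (v : ℂ) :
    fderiv ℝ (symDiag a b c d) (s, z) (0, v) = h / 2 *
      (b (s, z) * d (s, z) * Complex.exp (s * Complex.I) * conj v -
        a (s, z) * c (s, z) * Complex.exp (-(s * Complex.I)) * v) := by
  have ha := H.smooth_left s
  have hb := H.smooth_right s
  have hc := K.smooth_left s
  have hd := K.smooth_right s
  have hta := ((contDiffAt_fderiv_apply ha (1, 0)).differentiableAt (by simp)).hasFDerivAt
  have htb := ((contDiffAt_fderiv_apply hb (1, 0)).differentiableAt (by simp)).hasFDerivAt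
  have ha := (ha.differentiableAt (by simp)).hasFDerivAt
  have hb := (hb.differentiableAt (by simp)).hasFDerivAt
  have hc := (hc.differentiableAt (by simp)).hasFDerivAt
  have hd := (hd.differentiableAt (by simp)).hasFDerivAt
  have h1 : HasFDerivAt (symDiag a b c d) _ (s, z) :=
    (((hta.mul hd).sub (htb.mul hc)).neg).sub
      (((ha.mul hd).add (hb.mul hc)).const_mul (Complex.I / 2))
  rw [h1.fderiv]
  simp only [_root_.add_apply, _root_.neg_apply,
    _root_.sub_apply, _root_.smul_apply, smul_eq_mul]
  rw [H.mixed_left, H.mixed_right, H.deriv_left, H.deriv_right, K.deriv_left, K.deriv_right]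
  linear_combination (-(h : ℂ) / 2 * (b (s, z) * d (s, z) * Complex.exp (s * Complex.I) * conj v -
        a (s, z) * c (s, z) * Complex.exp (-(s * Complex.I)) * v)) * Complex.I_sq

/-- The derivative of the loop derivative of the Sym formula: `-(1/2) ∂_v ∂_θ M` is
`(1/2) [M, ∂_v M] + ∂_{iv} M` on the diagonal. -/
theorem fderiv_fderiv_symDiag (H : IsLoopPrimitive a b h Q R κ z)
    (K : IsLoopPrimitive c d h Q R κ z)
    (hdet : ∀ s : ℝ, a (s, z) * d (s, z) - b (s, z) * c (s, z) = 1) (v : ℂ) :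
    -(1 / 2) * fderiv ℝ (fun q => fderiv ℝ (symDiag a b c d) q (1, 0)) (0, z) (0, v) =
      1 / 2 * (symOff a b (0, z) * (h / 2 * (d (0, z) ^ 2 * conj v - c (0, z) ^ 2 * v)) -
        fderiv ℝ (symOff a b) (0, z) (0, v) * (symOff d c (0, z) - 2 * Complex.I * (c (0, z) * d (0, z)))) +
        fderiv ℝ (symDiag a b c d) (0, z) (0, Complex.I * v) := by
  rw [fderiv_fderiv_apply_comm (H.contDiffAt_symDiag K 0)]
  have h1 := hasDerivAt_fst_slice
    ((contDiffAt_fderiv_apply (H.contDiffAt_symDiag K 0) (0, v)).differentiableAt (by simp))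
  have h3 : (fun r : ℝ => fderiv ℝ (symDiag a b c d) (r, z) (0, v)) = _ :=
    funext fun r => H.fderiv_symDiag K r v
  have ha := hasDerivAt_fst_slice ((H.smooth_left 0).differentiableAt (by simp))
  have hb := hasDerivAt_fst_slice ((H.smooth_right 0).differentiableAt (by simp))
  have hc := hasDerivAt_fst_slice ((K.smooth_left 0).differentiableAt (by simp))
  have hd := hasDerivAt_fst_slice ((K.smooth_right 0).differentiableAt (by simp))
  have h2 := ((((hb.mul hd).mul (hasDerivAt_exp_mul_I 0)).mul_const (conj v)).sub
    (((ha.mul hc).mul (hasDerivAt_exp_neg_mul_I 0)).mul_const v)).const_mul ((h : ℂ) / 2)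
  rw [h3] at h1
  -- The determinant is identically 1 in θ, so its θ-derivative vanishes; the final identity holds
  -- only modulo these two relations, `h6` and `h7`.
  have h4 := (ha.mul hd).sub (hb.mul hc)
  have h5 : HasDerivAt (fun r : ℝ => a (r, z) * d (r, z) - b (r, z) * c (r, z)) 0 0 := by
    simp only [hdet]; exact hasDerivAt_const _ _
  have h6 := h5.unique h4
  rw [h1.unique h2, H.fderiv_symOff, H.fderiv_symDiag K]
  have h7 := hdet 0
  simp only [symOff, Pi.mul_apply, Complex.ofReal_zero, zero_mul, neg_zero, Complex.exp_zero, map_mul,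
    Complex.conj_I, one_mul, mul_one]
  generalize fderiv ℝ a (0, z) (1, 0) = a' at *
  generalize fderiv ℝ b (0, z) (1, 0) = b' at *
  generalize fderiv ℝ c (0, z) (1, 0) = c' at *
  generalize fderiv ℝ d (0, z) (1, 0) = d' at *
  generalize a (0, z) = A at *
  generalize b (0, z) = B at *
  generalize c (0, z) = C at *
  generalize d (0, z) = E at *
  generalize conj v = w at *
  linear_combination ((h : ℂ) / 4 * (w * (B * E) - v * (A * C))) * h6 +
    ((h : ℂ) / 4 * (w * (b' * E + B * d' - Complex.I * B * E) -
      v * (a' * C + A * c' + Complex.I * A * C))) * h7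

end IsLoopPrimitive

/-! ### From extended frames to their matrix entries -/

theorem fderiv_apply_eq_wirtinger (G : ℂ → ℂ) (z v : ℂ) :
    fderiv ℝ G z v = v * wirtinger G z + conj v * wirtingerBar G z := by
  have hv : v = v.re • (1 : ℂ) + v.im • Complex.I := by
    simp [Complex.re_add_im]
  have hc : conj v = v.re - v.im * Complex.I := by
    apply Complex.ext <;> simp
  have hv' : v = v.re + v.im * Complex.I := (Complex.re_add_im v).symm
  have h1 : fderiv ℝ G z v = v.re * fderiv ℝ G z 1 + v.im * fderiv ℝ G z Complex.I := by
    conv_lhs => rw [hv]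
    rw [map_add, map_smul, map_smul]
    simp
  rw [h1, hc, wirtinger, wirtingerBar]
  nth_rw 3 [hv']
  linear_combination (v.im * fderiv ℝ G z Complex.I) * Complex.I_sq

theorem IsSU11.entries {M : Matrix (Fin 2) (Fin 2) ℂ} (h : IsSU11 M) :
    M 1 0 = conj (M 0 1) ∧ M 1 1 = conj (M 0 0) ∧ M 0 0 * M 1 1 - M 0 1 * M 1 0 = 1 := by
  obtain ⟨h1, h2⟩ := h
  rw [det_fin_two] at h2
  have e (i j : Fin 2) := congrFun (congrFun h1 i) j
  have e00 := e 0 0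
  have e01 := e 0 1
  simp only [pauli₃, mul_apply, conjTranspose_apply, Fin.sum_univ_two, of_apply, cons_val', cons_val_zero,
    cons_val_one, cons_val_fin_one, mul_one, mul_zero, add_zero, zero_add, mul_neg, RCLike.star_def] at e00 e01
  refine ⟨?_, ?_, h2⟩
  · apply star_injective
    simp only [RCLike.star_def, Complex.conj_conj]
    linear_combination (-conj (M 1 0)) * h2 - M 0 0 * e01 + M 0 1 * e00
  · linear_combination conj (M 0 0) * h2 - M 1 1 * e00 + M 1 0 * e01

theorem inv_fin_two_of_det_eq_one {M : Matrix (Fin 2) (Fin 2) ℂ}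
    (h : M 0 0 * M 1 1 - M 0 1 * M 1 0 = 1) : M⁻¹ = !![M 1 1, -M 0 1; -M 1 0, M 0 0] := by
  rw [inv_def, det_fin_two, h, Ring.inverse_one, one_smul, adjugate_fin_two]

/-- An entry of a loop of matrices, as a function of `θ` (`λ = e^{iθ}`) and `z`. -/
noncomputable def frameEntry (F : Circle → ℂ → Matrix (Fin 2) (Fin 2) ℂ) (i j : Fin 2) (p : ℝ × ℂ) : ℂ :=
  F (Circle.exp p.1) p.2 i j

theorem loopDeriv_circleExp (G : Circle → Matrix (Fin 2) (Fin 2) ℂ) (s : ℝ) (i j : Fin 2) :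
    loopDeriv G (Circle.exp s) i j = deriv (fun r : ℝ => G (Circle.exp r) i j) s := by
  simp only [loopDeriv, of_apply, ← Circle.exp_add]
  rw [deriv_comp_add_const (fun r : ℝ => G (Circle.exp r) i j), zero_add]

namespace IsExtendedFrame

variable {U : Set ℂ} {F : Circle → ℂ → Matrix (Fin 2) (Fin 2) ℂ}

theorem contDiffAt_frameEntry (hF : IsExtendedFrame U F) (hU : IsOpen U) (i j : Fin 2) (s : ℝ) {z : ℂ}
    (hz : z ∈ U) : ContDiffAt ℝ ∞ (frameEntry F i j) (s, z) :=
  (hF.smooth i j).contDiffAt ((isOpen_univ.prod hU).mem_nhds ⟨mem_univ _, hz⟩)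

theorem exists_isLoopPrimitive (hF : IsExtendedFrame U F) (hU : IsOpen U) :
    ∃ (h : ℂ → ℝ) (Q R : ℂ → ℂ) (κ : ℂ → ℂ → ℂ), ∀ z ∈ U, 0 < h z ∧ ∀ i,
      IsLoopPrimitive (frameEntry F i 0) (frameEntry F i 1) (h z) (Q z) (R z) (κ z) z := by
  obtain ⟨h, B, -, hpos, -, hmc⟩ := hF.maurerCartan
  -- With D = e^{w/2} = ih/4, these are Q = B̄/D, R = B/D and the diagonal form κ(v) = (w_z v - w_z̄
  -- v̄)/4, none of which depends on the loop parameter.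
  refine ⟨h, fun z => conj (B z) / (Complex.I / 4 * h z), fun z => B z / (Complex.I / 4 * h z),
    fun z v => v * (2 * wirtinger (fun ζ => (h ζ : ℂ)) z / h z / 4) -
      conj v * (2 * wirtingerBar (fun ζ => (h ζ : ℂ)) z / h z / 4), fun z hz => ⟨hpos z hz, fun i => ?_⟩⟩
  have key (j : Fin 2) (s : ℝ) (v : ℂ) : fderiv ℝ (frameEntry F i j) (s, z) (0, v) =
      v * (F (Circle.exp s) z * frameU h B (Circle.exp s) z) i j +
      conj v * (F (Circle.exp s) z * frameV h B (Circle.exp s) z) i j := by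
    have h1 := (hasFDerivAt_snd_slice
      ((hF.contDiffAt_frameEntry hU i j s hz).differentiableAt (by simp))).fderiv
    have h2 := DFunLike.congr_fun h1 v
    simp only [ContinuousLinearMap.comp_apply, ContinuousLinearMap.inr_apply] at h2
    rw [← h2, fderiv_apply_eq_wirtinger, ← (hmc (Circle.exp s) z hz).1, ← (hmc (Circle.exp s) z hz).2]
    rfl
  constructor
  · exact fun s => hF.contDiffAt_frameEntry hU i 0 s hz
  · exact fun s => hF.contDiffAt_frameEntry hU i 1 s hz
  · intro s v
    rw [key]
    simp only [frameU, frameV, mul_apply, Fin.sum_univ_two, of_apply, cons_val', cons_val_zero, cons_val_one,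
      cons_val_fin_one, Circle.coe_exp, frameEntry, Complex.exp_neg]
    ring
  · intro s v
    rw [key]
    simp only [frameU, frameV, mul_apply, Fin.sum_univ_two, of_apply, cons_val', cons_val_zero, cons_val_one,
      cons_val_fin_one, Circle.coe_exp, frameEntry, Complex.exp_neg]
    ring

theorem loopDeriv_apply (hF : IsExtendedFrame U F) (hU : IsOpen U) {z : ℂ} (hz : z ∈ U) (s : ℝ)
    (i j : Fin 2) : loopDeriv (fun m => F m z) (Circle.exp s) i j =
      fderiv ℝ (frameEntry F i j) (s, z) (1, 0) := by
  rw [loopDeriv_circleExp]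
  exact (hasDerivAt_fst_slice
    ((hF.contDiffAt_frameEntry hU i j s hz).differentiableAt (by simp))).deriv

theorem symMatrix_zero_zero (hF : IsExtendedFrame U F) (hU : IsOpen U) {z : ℂ} (hz : z ∈ U) (s : ℝ) :
    symMatrix F (Circle.exp s) z 0 0 = symDiag (frameEntry F 0 0) (frameEntry F 0 1)
      (frameEntry F 1 0) (frameEntry F 1 1) (s, z) := by
  obtain ⟨-, -, hdet⟩ := (hF.mem_SU11 (Circle.exp s) z hz).entries
  simp only [symMatrix, symNormal, inv_fin_two_of_det_eq_one hdet, Matrix.sub_apply, Matrix.neg_apply,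
    Matrix.smul_apply,
    mul_apply, Fin.sum_univ_two, hF.loopDeriv_apply hU hz, pauli₃, of_apply, cons_val', cons_val_zero,
    cons_val_one, cons_val_fin_one, symDiag, smul_eq_mul]
  simp only [frameEntry]
  ring

theorem symMatrix_zero_one (hF : IsExtendedFrame U F) (hU : IsOpen U) {z : ℂ} (hz : z ∈ U) (s : ℝ) :
    symMatrix F (Circle.exp s) z 0 1 = symOff (frameEntry F 0 0) (frameEntry F 0 1) (s, z) := by
  obtain ⟨-, -, hdet⟩ := (hF.mem_SU11 (Circle.exp s) z hz).entries
  simp only [symMatrix, symNormal, inv_fin_two_of_det_eq_one hdet, Matrix.sub_apply, Matrix.neg_apply,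
    Matrix.smul_apply,
    mul_apply, Fin.sum_univ_two, hF.loopDeriv_apply hU hz, pauli₃, of_apply, cons_val', cons_val_zero,
    cons_val_one, cons_val_fin_one, symOff, smul_eq_mul]
  simp only [frameEntry]
  ring

end IsExtendedFrame

theorem suCoord_eq (X : Matrix (Fin 2) (Fin 2) ℂ) :
    suCoord X = (-2 * Complex.I * X 0 1, -2 * (X 0 0).im) := by
  refine Prod.ext (Complex.ext ?_ ?_) rfl <;> simp [suCoord]

/-! ### The differentials of the surfaces in Minkowski space and in Nil₃ -/

namespace IsExtendedFrame

variable {U : Set ℂ} {F : Circle → ℂ → Matrix (Fin 2) (Fin 2) ℂ}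

theorem cmcSurface_eq (hF : IsExtendedFrame U F) (hU : IsOpen U) {z : ℂ} (hz : z ∈ U) :
    cmcSurface F 1 z = (-2 * Complex.I * symOff (frameEntry F 0 0) (frameEntry F 0 1) (0, z),
      -2 * (symDiag (frameEntry F 0 0) (frameEntry F 0 1)
        (frameEntry F 1 0) (frameEntry F 1 1) (0, z)).im) := by
  rw [cmcSurface, ← Circle.exp_zero, suCoord_eq, hF.symMatrix_zero_zero hU hz,
    hF.symMatrix_zero_one hU hz]

theorem nilSurface_fst (F : Circle → ℂ → Matrix (Fin 2) (Fin 2) ℂ) (l : Circle) (z : ℂ) :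
    (nilSurface F l z).1 = (cmcSurface F l z).1 := by
  simp [nilSurface, cmcSurface, suCoord, symNilMatrix]

theorem nilSurface_snd (hF : IsExtendedFrame U F) (hU : IsOpen U) {z : ℂ} (hz : z ∈ U) :
    (nilSurface F 1 z).2 = -2 * (-(1 / 2) * fderiv ℝ (symDiag (frameEntry F 0 0) (frameEntry F 0 1)
        (frameEntry F 1 0) (frameEntry F 1 1)) (0, z) (1, 0)).im := by
  obtain ⟨h, Q, R, κ, H⟩ := hF.exists_isLoopPrimitive hU
  have h1 := (hasDerivAt_fst_slice ((((H z hz).2 0).contDiffAt_symDiag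
    ((H z hz).2 1) 0).differentiableAt (by simp))).deriv
  rw [nilSurface, ← Circle.exp_zero, suCoord_eq]
  simp only [symNilMatrix, of_apply, if_true, loopDeriv_circleExp]
  rw [← h1]
  simp only [hF.symMatrix_zero_zero hU hz]

/-- In SU(1,1) the lower row is the reversed conjugate of the upper row. Conjugation also flips the
sign of the factor i in the normal term, and the correction 2i·cd accounts for this. The result is
the lower left entry of the Sym matrix, needed in the commutator formula for the height. -/
theorem conj_symOff (hF : IsExtendedFrame U F) (hU : IsOpen U) {z : ℂ} (hz : z ∈ U) :
    symOff (frameEntry F 1 1) (frameEntry F 1 0) (0, z) -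
        2 * Complex.I * (frameEntry F 1 0 (0, z) * frameEntry F 1 1 (0, z)) =
      conj (symOff (frameEntry F 0 0) (frameEntry F 0 1) (0, z)) := by
  have hd (i j : Fin 2) := hasDerivAt_fst_slice
    ((hF.contDiffAt_frameEntry hU i j 0 hz).differentiableAt (by simp))
  have hc : (fun r : ℝ => frameEntry F 1 0 (r, z)) = fun r => conj (frameEntry F 0 1 (r, z)) :=
    funext fun r => (hF.mem_SU11 _ z hz).entries.1
  have ha : (fun r : ℝ => frameEntry F 1 1 (r, z)) = fun r => conj (frameEntry F 0 0 (r, z)) :=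
    funext fun r => (hF.mem_SU11 _ z hz).entries.2.1
  have h10 := hd 1 0
  have h11 := hd 1 1
  rw [hc] at h10
  rw [ha] at h11
  have e10 := h10.unique (hd 0 1).star
  have e11 := h11.unique (hd 0 0).star
  simp only [symOff, e10, e11, congrFun hc 0, congrFun ha 0]
  simp only [map_add, map_neg, map_sub, map_mul, Complex.conj_I, RCLike.star_def]
  ring

/-- The derivatives of the two surfaces given by an extended frame. -/
theorem exists_surface_fderiv (hF : IsExtendedFrame U F) (hU : IsOpen U) :
    ∃ (h : ℂ → ℝ) (R : ℂ → ℂ) (κ : ℂ → ℂ → ℂ), ∀ z ∈ U, 0 < h z ∧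
      (∀ i, DifferentiableAt ℝ (fun ζ => F 1 ζ i 0) z) ∧
      DifferentiableAt ℝ (fun ζ => (cmcSurface F 1 ζ).1) z ∧
      DifferentiableAt ℝ (fun ζ => (cmcSurface F 1 ζ).2) z ∧
      DifferentiableAt ℝ (fun ζ => (nilSurface F 1 ζ).2) z ∧ ∀ v,
      (∀ i, fderiv ℝ (fun ζ => F 1 ζ i 0) z v =
        F 1 z i 0 * κ z v + F 1 z i 1 * (R z * v + Complex.I / 4 * h z * conj v)) ∧
      fderiv ℝ (fun ζ => (cmcSurface F 1 ζ).1) z v =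
        -Complex.I * h z * (F 1 z 0 0 ^ 2 * v - F 1 z 0 1 ^ 2 * conj v) ∧
      fderiv ℝ (fun ζ => (cmcSurface F 1 ζ).2) z v =
        2 * h z * (F 1 z 0 0 * conj (F 1 z 0 1) * v).im ∧
      fderiv ℝ (fun ζ => (nilSurface F 1 ζ).2) z v =
        1 / 2 * (conj (cmcSurface F 1 z).1 * fderiv ℝ (fun ζ => (cmcSurface F 1 ζ).1) z v).im +
          fderiv ℝ (fun ζ => (cmcSurface F 1 ζ).2) z (Complex.I * v) := by
  obtain ⟨h, Q, R, κ, H⟩ := hF.exists_isLoopPrimitive hU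
  refine ⟨h, R, κ, fun z hz => ?_⟩
  obtain ⟨hpos, H⟩ := H z hz
  have hH := H 0
  have hK := H 1
  set a := frameEntry F 0 0
  set b := frameEntry F 0 1
  set c := frameEntry F 1 0
  set d := frameEntry F 1 1
  have hF1 (i : Fin 2) : HasFDerivAt (fun ζ => F 1 ζ i 0)
      ((fderiv ℝ (frameEntry F i 0) (0, z)).comp (ContinuousLinearMap.inr ℝ ℝ ℂ)) z := by
    have := hasFDerivAt_snd_slice ((H i).smooth_left 0 |>.differentiableAt (by simp))
    simpa only [frameEntry, Circle.exp_zero] using this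
  have hoff := (hasFDerivAt_snd_slice ((hH.contDiffAt_symOff 0).differentiableAt (by simp))).const_mul
    (-2 * Complex.I)
  have hdiag := (Complex.imCLM.hasFDerivAt.comp z (hasFDerivAt_snd_slice
    ((hH.contDiffAt_symDiag hK 0).differentiableAt (by simp)))).const_mul (-2)
  have hnil := (Complex.imCLM.hasFDerivAt.comp z ((hasFDerivAt_snd_slice
    ((contDiffAt_fderiv_apply (hH.contDiffAt_symDiag hK 0) (1, 0)).differentiableAt
      (by simp))).const_mul (-(1 / 2) : ℂ))).const_mul (-2)
  have hUz := hU.mem_nhds hz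
  have hf1 := hoff.congr_of_eventuallyEq (f₁ := fun ζ => (cmcSurface F 1 ζ).1) (by
    filter_upwards [hUz] with ζ hζ
    rw [hF.cmcSurface_eq hU hζ])
  have hf2 := hdiag.congr_of_eventuallyEq (f₁ := fun ζ => (cmcSurface F 1 ζ).2) (by
    filter_upwards [hUz] with ζ hζ
    rw [hF.cmcSurface_eq hU hζ]
    rfl)
  have hg := hnil.congr_of_eventuallyEq (f₁ := fun ζ => (nilSurface F 1 ζ).2) (by
    filter_upwards [hUz] with ζ hζ
    rw [hF.nilSurface_snd hU hζ]
    rfl)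
  refine ⟨hpos, fun i => (hF1 i).differentiableAt, hf1.differentiableAt, hf2.differentiableAt,
    hg.differentiableAt, fun v => ?_⟩
  rw [hf1.fderiv, hf2.fderiv, hg.fderiv]
  have hSU : IsSU11 (F 1 z) := hF.mem_SU11 1 z hz
  obtain ⟨h10, h11, hdet⟩ := hSU.entries
  have ea : a (0, z) = F 1 z 0 0 := by simp [a, frameEntry]
  have eb : b (0, z) = F 1 z 0 1 := by simp [b, frameEntry]
  have ec : c (0, z) = conj (F 1 z 0 1) := by simp [c, frameEntry, h10]
  have ed : d (0, z) = conj (F 1 z 0 0) := by simp [d, frameEntry, h11]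
  have hnilv := hH.fderiv_fderiv_symDiag hK (fun s => (hF.mem_SU11 (Circle.exp s) z hz).entries.2.2) v
  rw [hF.conj_symOff hU hz, ec, ed] at hnilv
  have hoffv := hH.fderiv_symOff 0 v
  have hdiagv := hH.fderiv_symDiag hK 0
  simp only [Complex.ofReal_zero, zero_mul, neg_zero, Complex.exp_zero, mul_one, ea, eb, ec, ed]
    at hoffv hdiagv
  refine ⟨fun i => ?_, ?_, ?_, ?_⟩
  · rw [(hF1 i).fderiv]
    have := (H i).deriv_left 0 v
    simpa [frameEntry] using this
  · simp only [_root_.smul_apply, ContinuousLinearMap.comp_apply, ContinuousLinearMap.inr_apply, hoffv,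
      smul_eq_mul]
    ring
  · simp only [_root_.smul_apply, ContinuousLinearMap.comp_apply, ContinuousLinearMap.inr_apply, hdiagv,
      smul_eq_mul, Complex.imCLM_apply]
    simp
    ring
  · simp only [_root_.smul_apply, ContinuousLinearMap.comp_apply, ContinuousLinearMap.inr_apply,
      smul_eq_mul, Complex.imCLM_apply]
    rw [hnilv, hoffv, hF.cmcSurface_eq hU hz]
    generalize symOff a b (0, z) = S
    generalize fderiv ℝ (symDiag a b c d) (0, z) (0, Complex.I * v) = T
    generalize F 1 z 0 0 = A
    generalize F 1 z 0 1 = B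
    -- The commutator contributes S X̄ - X S̄ = -2i Im(S̄ X), where X is the derivative of the
    -- off-diagonal entry S; this is the source of the area term ½ Im(ζ̄ dζ).
    have e1 : (1 / 2 * (S * (h z / 2 * (conj A ^ 2 * conj v - conj B ^ 2 * v)) -
        h z / 2 * (A ^ 2 * v - B ^ 2 * conj v) * conj S) + T).im =
        -(conj S * (h z / 2 * (A ^ 2 * v - B ^ 2 * conj v))).im + T.im := by
      set X := (h z : ℂ) / 2 * (A ^ 2 * v - B ^ 2 * conj v)
      have : (h z : ℂ) / 2 * (conj A ^ 2 * conj v - conj B ^ 2 * v) = conj X := by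
        simp [X, map_ofNat]
      rw [this]
      simp
      ring
    rw [e1]
    set X := (h z : ℂ) / 2 * (A ^ 2 * v - B ^ 2 * conj v)
    simp
    ring

end IsExtendedFrame

/-! ### Rigidity of orthonormal coframes for the Heisenberg structure equations -/

section FrameRigidity

variable {R : Type*} [CommRing R]

/-- The structure constants of the Heisenberg Lie algebra, `[X₁, X₂] = X₃`. -/
def heisenbergSign (i k : Fin 3) : R :=
  if i = 0 ∧ k = 1 then 1 else if i = 1 ∧ k = 0 then -1 else 0

/-- The torsion coefficients of an orthonormal coframe with matrix `O`, pulled back from `Nil₃`. -/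
def coframeTorsion (O : Matrix (Fin 3) (Fin 3) R) (l i k : Fin 3) : R :=
  heisenbergSign i k * (if l = 2 then 1 else 0) - O 2 l * (O 0 i * O 1 k - O 0 k * O 1 i)

variable [Algebra ℝ R]

theorem eq_of_two_mul_eq {x y : R} (h : 2 * x = 2 * y) : x = y := by
  have h2 : algebraMap ℝ R (1 / 2) * 2 = 1 := by
    rw [← map_ofNat (algebraMap ℝ R) 2, ← map_mul]
    norm_num
  linear_combination (algebraMap ℝ R (1 / 2)) * h + (y - x) * h2

/-- The structure equations satisfied by the matrix `O` of the differential of an isometry of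
`Nil₃` with respect to the left-invariant frame. -/
structure IsNilCoframe (X : Fin 3 → Derivation ℝ R R) (O : Matrix (Fin 3) (Fin 3) R) : Prop where
  commutator : ∀ i k f, X i (X k f) - X k (X i f) = heisenbergSign i k * X 2 f
  orthogonal : Oᵀ * O = 1
  torsion : ∀ i j k, X i (O j k) - X k (O j i) = heisenbergSign i k * O j 2 -
    (if j = 2 then 1 else 0) * (O 0 i * O 1 k - O 0 k * O 1 i)

/-- The rows of O are the pullbacks of dx₁, dx₂ and the contact form ω under the map (u, w, y). The
torsion identities are ddu = ddw = 0 and dω = -dx₁ ∧ dx₂, evaluated on the frame. -/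
theorem isNilCoframe_of_coordinates {X : Fin 3 → Derivation ℝ R R} {O : Matrix (Fin 3) (Fin 3) R}
    (hX : ∀ i k f, X i (X k f) - X k (X i f) = heisenbergSign i k * X 2 f)
    (hO : Oᵀ * O = 1) {u w y : R} (h0 : ∀ i, O 0 i = X i u) (h1 : ∀ i, O 1 i = X i w)
    (h2 : ∀ i, 2 * O 2 i = 2 * X i y + (w * X i u - u * X i w)) : IsNilCoframe X O := by
  refine ⟨hX, hO, fun i j k => ?_⟩
  fin_cases j
  · simp [h0, hX]
  · simp [h1, hX]
  · apply eq_of_two_mul_eq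
    have two (i k : Fin 3) : 2 * X i (O 2 k) = 2 * X i (X k y) +
        (w * X i (X k u) + X k u * X i w - (u * X i (X k w) + X k w * X i u)) := by
      have := congrArg (X i) (h2 k)
      have e2 : X i (2 : R) = 0 := by
        have := (X i).map_algebraMap 2
        rwa [map_ofNat] at this
      simpa [e2] using this
    simp only [Fin.reduceFinMk, if_true]
    rw [h0, h0, h1, h1]
    linear_combination two i k - two k i + 2 * hX i k y + w * hX i k u - u * hX i k w -
      heisenbergSign i k * h2 2

namespace IsNilCoframe

variable {X : Fin 3 → Derivation ℝ R R} {O : Matrix (Fin 3) (Fin 3) R}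

/-- This is the Koszul argument. Orthogonality makes the coefficients of O⁻¹dO skew in two indices,
and the structure equations give their antisymmetrization in another pair, so together they
determine them. -/
theorem two_mul_apply (H : IsNilCoframe X O) (i j k : Fin 3) :
    2 * X i (O j k) = ∑ l, O j l *
      (coframeTorsion O l i k - coframeTorsion O i k l + coframeTorsion O k l i) := by
  have hO' : O * Oᵀ = 1 := mul_eq_one_comm.mp H.orthogonal
  set A : Fin 3 → Fin 3 → Fin 3 → R := fun i l k => ∑ j, O j l * X i (O j k) with hA
  have orth (l k : Fin 3) : ∑ j, O j l * O j k = (1 : Matrix (Fin 3) (Fin 3) R) l k := by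
    rw [← H.orthogonal, mul_apply]; rfl
  have orth' (j m : Fin 3) : ∑ l, O j l * O m l = (1 : Matrix (Fin 3) (Fin 3) R) j m := by
    rw [← hO', mul_apply]; rfl
  have anti (i l k : Fin 3) : A i l k = -A i k l := by
    have h1 := congrArg (X i) (orth l k)
    have h2 : X i ((1 : Matrix (Fin 3) (Fin 3) R) l k) = 0 := by
      rw [one_apply]; split_ifs <;> simp
    rw [h2, map_sum] at h1
    simp only [Derivation.leibniz, smul_eq_mul, Finset.sum_add_distrib] at h1
    linear_combination h1
  have tor (l i k : Fin 3) : A i l k - A k l i = coframeTorsion O l i k := by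
    have e0 := orth l 2
    simp only [hA, coframeTorsion, ← Finset.sum_sub_distrib, ← mul_sub, H.torsion]
    rw [one_apply] at e0
    rw [← e0]
    simp [Fin.sum_univ_three]
    ring
  have kos (l : Fin 3) : coframeTorsion O l i k - coframeTorsion O i k l + coframeTorsion O k l i =
      2 * A i l k := by
    rw [← tor, ← tor, ← tor]
    linear_combination -anti k i l + anti l k i - anti i k l
  simp only [kos]
  have e (m : Fin 3) := orth' j m
  have : X i (O j k) = ∑ m, (∑ l, O j l * O m l) * X i (O m k) := by
    simp [e, one_apply]
  rw [this]
  simp only [hA, Fin.sum_univ_three]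
  ring

/-- Let n be the third row of O and d = det O. The cofactors of n are d·n, so Koszul's formula
expresses every Xᵢnₖ through d and n. Applying [X₀, X₁] = X₂ to n₀ and n₁ gives ((3 + d²)/4)·n₁ = 0
and the same for n₀, with coefficient 1 because d² = 1. Thus n is vertical, d = 1, and all torsion
terms vanish. -/
theorem rigid (H : IsNilCoframe X O) :
    O 2 0 = 0 ∧ O 2 1 = 0 ∧ O 2 2 * O 2 2 = 1 ∧ O 0 0 * O 1 1 - O 0 1 * O 1 0 = O 2 2 ∧
      ∀ i j k, X i (O j k) = 0 := by
  have hO' : O * Oᵀ = 1 := mul_eq_one_comm.mp H.orthogonal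
  obtain ⟨d, hd⟩ : ∃ d, d = O.det := ⟨_, rfl⟩
  have hdd : d * d = 1 := by
    have := congrArg det H.orthogonal
    rwa [det_mul, det_transpose, det_one, ← hd] at this
  have hadj : adjugate O = d • Oᵀ := by
    calc adjugate O = adjugate O * (O * Oᵀ) := by rw [hO', mul_one]
      _ = d • Oᵀ := by rw [← mul_assoc, adjugate_mul, hd, smul_mul, one_mul]
  rw [adjugate_fin_three] at hadj
  have c01 := congrFun (congrFun hadj 2) 2
  have c12 := congrFun (congrFun hadj 0) 2
  have c02 := congrFun (congrFun hadj 1) 2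
  have hn := congrFun (congrFun hO' 2) 2
  simp only [of_apply, cons_val', cons_val_zero, cons_val_one, cons_val, cons_val_fin_one, Matrix.smul_apply,
    transpose_apply, smul_eq_mul, mul_apply, Fin.sum_univ_three, one_apply_eq] at c01 c12 c02 hn
  have r0 := congrFun (congrFun hO' 2) 0
  have r1 := congrFun (congrFun hO' 2) 1
  rw [mul_apply, Fin.sum_univ_three, one_apply_ne (by decide)] at r0 r1
  simp only [transpose_apply] at r0 r1
  have z02 : ((0 : Fin 3) = 2) = False := by simp
  have z12 : ((1 : Fin 3) = 2) = False := by simp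
  have key (i k : Fin 3) : 2 * X i (O 2 k) = heisenbergSign i k * O 2 2 -
      (O 0 i * O 1 k - O 0 k * O 1 i) -
      (if i = 2 then 1 else 0) * (O 2 0 * heisenbergSign k 0 + O 2 1 * heisenbergSign k 1) +
      (if k = 2 then 1 else 0) * (O 2 0 * heisenbergSign 0 i + O 2 1 * heisenbergSign 1 i) := by
    rw [H.two_mul_apply]
    have s0 : heisenbergSign k 2 = (0 : R) := by simp [heisenbergSign]
    have s1 : heisenbergSign 2 i = (0 : R) := by simp [heisenbergSign]
    simp only [Fin.sum_univ_three, coframeTorsion, z02, z12, if_false, if_true, s0, s1]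
    linear_combination (-(O 0 i * O 1 k - O 0 k * O 1 i)) * hn +
      O 2 i * (O 0 k * r1 - O 1 k * r0) - O 2 k * (O 1 i * r0 - O 0 i * r1)
  have e01 : 2 * X 0 (O 2 1) = (1 - d) * O 2 2 := by
    rw [key]; simp [heisenbergSign]; linear_combination -c01
  have e02 : 2 * X 0 (O 2 2) = -((1 - d) * O 2 1) := by
    rw [key]; simp [heisenbergSign]; linear_combination c02
  have e10 : 2 * X 1 (O 2 0) = -((1 - d) * O 2 2) := by
    rw [key]; simp [heisenbergSign]; linear_combination c01
  have e00 : 2 * X 0 (O 2 0) = 0 := by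
    rw [key]; simp [heisenbergSign]
  have e11 : 2 * X 1 (O 2 1) = 0 := by
    rw [key]; simp [heisenbergSign]
  have e12 : 2 * X 1 (O 2 2) = (1 - d) * O 2 0 := by
    rw [key]; simp [heisenbergSign]; linear_combination -c12
  have e20 : 2 * X 2 (O 2 0) = -((1 + d) * O 2 1) := by
    rw [key]; simp [heisenbergSign]; linear_combination -c02
  have e21 : 2 * X 2 (O 2 1) = (1 + d) * O 2 0 := by
    rw [key]; simp [heisenbergSign]; linear_combination c12
  have cancel {x y : R} (h : 2 * x = 2 * y) : x = y := eq_of_two_mul_eq h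
  have e2 (i : Fin 3) : X i (2 : R) = 0 := by
    have := (X i).map_algebraMap 2
    rwa [map_ofNat] at this
  -- The coefficient ring may have zero divisors, so d = ±1 cannot be inferred from d² = 1; but
  -- differentiating d² = 1 and multiplying by d shows that d is constant.
  have hXd (i : Fin 3) : X i d = 0 := by
    have h1 := congrArg (X i) hdd
    simp only [Derivation.leibniz, smul_eq_mul, Derivation.map_one_eq_zero] at h1
    apply cancel
    linear_combination d * h1 - 2 * X i d * hdd
  have mul2 {i j : Fin 3} {x y : R} (h : 2 * X j x = y) : 2 * X i (X j x) = X i y := by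
    rw [← h]; simp [e2]
  have n1 : O 2 1 = 0 := by
    have h1 := mul2 (i := 0) e10
    have h2 := mul2 (i := 1) e00
    have h3 := H.commutator 0 1 (O 2 0)
    simp [hXd, heisenbergSign] at h1 h2 h3
    apply cancel
    apply cancel
    linear_combination 4 * h3 - 2 * h1 + 2 * h2 + 2 * e20 + (1 - d) * e02 - O 2 1 * hdd
  have n0 : O 2 0 = 0 := by
    have h1 := mul2 (i := 0) e11
    have h2 := mul2 (i := 1) e01
    have h3 := H.commutator 0 1 (O 2 1)
    simp [hXd, heisenbergSign] at h1 h2 h3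
    apply cancel
    apply cancel
    linear_combination (-4) * h3 + 2 * h1 - 2 * h2 - 2 * e21 - (1 - d) * e12 - O 2 0 * hdd
  have hnn : O 2 2 * O 2 2 = 1 := by
    rw [n0, n1] at hn; linear_combination hn
  -- With n₁ = 0 the formula for X₀n₁ reads (1 - d)n₂ = 0, and n₂ is invertible.
  have d1 : d = 1 := by
    rw [n1, map_zero] at e01
    linear_combination O 2 2 * e01 + (1 - d) * hnn
  subst d1
  refine ⟨n0, n1, hnn, by linear_combination c01, fun i j k => ?_⟩
  have tor (l i k : Fin 3) : coframeTorsion O l i k = 0 := by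
    have c (i k : Fin 3) : O 0 i * O 1 k - O 0 k * O 1 i = heisenbergSign i k * O 2 2 := by
      fin_cases i <;> fin_cases k <;> simp [heisenbergSign]
      · linear_combination c01
      · linear_combination -c02 - n1
      · linear_combination -c01
      · linear_combination c12 + n0
      · linear_combination c02 + n1
      · linear_combination -c12 - n0
    rw [coframeTorsion, c]
    fin_cases l
    · simp [n0]
    · simp [n1]
    · simp
      linear_combination (-heisenbergSign i k) * hnn
  apply cancel
  rw [H.two_mul_apply]
  simp [tor]

end IsNilCoframe

end FrameRigidity

/-! ### The left-invariant frame and the isometries of Nil₃ -/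

/-- The algebra of smooth real functions on `ℂ × ℝ`. -/
def smoothFunctions : Subalgebra ℝ (ℂ × ℝ → ℝ) where
  carrier := {f | ContDiff ℝ ∞ f}
  mul_mem' {f g} (hf : ContDiff ℝ ∞ f) (hg : ContDiff ℝ ∞ g) := hf.mul hg
  add_mem' {f g} (hf : ContDiff ℝ ∞ f) (hg : ContDiff ℝ ∞ g) := hf.add hg
  algebraMap_mem' r := (contDiff_const : ContDiff ℝ ∞ fun _ : ℂ × ℝ => r)

theorem contDiff_smoothFunctions (f : smoothFunctions) : ContDiff ℝ ∞ f.1 := f.2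

theorem differentiable_smoothFunctions (f : smoothFunctions) : Differentiable ℝ f.1 :=
  (contDiff_smoothFunctions f).differentiable (by simp)

/-- The left-invariant orthonormal frame of `Nil₃`. -/
noncomputable def nilFrame (i : Fin 3) (p : ℂ × ℝ) : ℂ × ℝ :=
  ![((1 : ℂ), -p.1.im / 2), (Complex.I, p.1.re / 2), (0, 1)] i

theorem contDiff_nilFrame (i : Fin 3) : ContDiff ℝ ∞ (nilFrame i) := by
  have hre : ContDiff ℝ ∞ fun p : ℂ × ℝ => p.1.re := Complex.reCLM.contDiff.comp contDiff_fst
  have him : ContDiff ℝ ∞ fun p : ℂ × ℝ => p.1.im := Complex.imCLM.contDiff.comp contDiff_fst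
  fin_cases i
  · exact contDiff_const.prodMk (him.neg.div_const 2)
  · exact contDiff_const.prodMk (hre.div_const 2)
  · exact contDiff_const

theorem fderiv_nilFrame (i : Fin 3) (p v : ℂ × ℝ) :
    fderiv ℝ (nilFrame i) p v = ![((0 : ℂ), -v.1.im / 2), (0, v.1.re / 2), (0, 0)] i := by
  have hre : HasFDerivAt (fun p : ℂ × ℝ => p.1.re) (Complex.reCLM.comp (ContinuousLinearMap.fst ℝ ℂ ℝ)) p :=
    Complex.reCLM.hasFDerivAt.comp p hasFDerivAt_fst
  have him : HasFDerivAt (fun p : ℂ × ℝ => p.1.im) (Complex.imCLM.comp (ContinuousLinearMap.fst ℝ ℂ ℝ)) p :=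
    Complex.imCLM.hasFDerivAt.comp p hasFDerivAt_fst
  fin_cases i
  · have : HasFDerivAt (nilFrame 0) _ p :=
      (hasFDerivAt_const (1 : ℂ) p).prodMk (him.neg.mul_const (2⁻¹))
    simp [this.fderiv]
    ring
  · have : HasFDerivAt (nilFrame 1) _ p :=
      (hasFDerivAt_const Complex.I p).prodMk (hre.mul_const (2⁻¹))
    simp [this.fderiv]
    ring
  · have : HasFDerivAt (nilFrame 2) (0 : ℂ × ℝ →L[ℝ] ℂ × ℝ) p := hasFDerivAt_const ((0 : ℂ), (1 : ℝ)) p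
    simp [this.fderiv]
    rfl

theorem nilMetric_nilFrame (i k : Fin 3) (p : ℂ × ℝ) :
    nilMetric p (nilFrame i p) (nilFrame k p) = if i = k then 1 else 0 := by
  have h (i : Fin 3) : nilForm p (nilFrame i p) = if i = 2 then 1 else 0 := by
    fin_cases i <;> simp [nilForm, nilFrame] <;> ring
  rw [nilMetric, h, h]
  fin_cases i <;> fin_cases k <;> simp [nilFrame]

/-- The left-invariant frame of `Nil₃`, acting on smooth functions. -/
noncomputable def nilDerivation (i : Fin 3) : Derivation ℝ smoothFunctions smoothFunctions :=
  Derivation.mk'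
    { toFun := fun f => ⟨fun p => fderiv ℝ f.1 p (nilFrame i p),
        ((contDiff_smoothFunctions f).fderiv_right (m := ∞) (by norm_cast)).clm_apply (contDiff_nilFrame i)⟩
      map_add' := fun f g => by
        ext p
        change fderiv ℝ (f.1 + g.1) p _ = _
        rw [fderiv_add (differentiable_smoothFunctions f p) (differentiable_smoothFunctions g p)]
        rfl
      map_smul' := fun c f => by
        ext p
        change fderiv ℝ (c • f.1) p _ = _
        rw [fderiv_const_smul (differentiable_smoothFunctions f p)]
        rfl }
    (fun f g => by
        ext p
        change fderiv ℝ (f.1 * g.1) p _ = _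
        rw [fderiv_mul (differentiable_smoothFunctions f p) (differentiable_smoothFunctions g p)]
        rfl)

theorem nilDerivation_apply (i : Fin 3) (f : smoothFunctions) (p : ℂ × ℝ) :
    (nilDerivation i f).1 p = fderiv ℝ f.1 p (nilFrame i p) := rfl

theorem nilDerivation_commutator (i k : Fin 3) (f : smoothFunctions) :
    nilDerivation i (nilDerivation k f) - nilDerivation k (nilDerivation i f) =
      heisenbergSign i k * nilDerivation 2 f := by
  ext p
  have hD : DifferentiableAt ℝ (fderiv ℝ f.1) p :=
    ((contDiff_smoothFunctions f).fderiv_right (m := 1) (by norm_cast)).differentiable one_ne_zero p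
  have e (i k : Fin 3) : (nilDerivation i (nilDerivation k f)).1 p =
      fderiv ℝ (fderiv ℝ f.1) p (nilFrame i p) (nilFrame k p) +
        fderiv ℝ f.1 p (fderiv ℝ (nilFrame k) p (nilFrame i p)) := by
    have h1 : HasFDerivAt (fun p => fderiv ℝ f.1 p (nilFrame k p)) _ p :=
      hD.hasFDerivAt.clm_apply ((contDiff_nilFrame k).differentiable (by simp) p).hasFDerivAt
    rw [nilDerivation_apply]
    change fderiv ℝ (fun p => fderiv ℝ f.1 p (nilFrame k p)) p _ = _
    rw [h1.fderiv]
    simp [add_comm]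
  have hs : fderiv ℝ (fderiv ℝ f.1) p (nilFrame i p) (nilFrame k p) =
      fderiv ℝ (fderiv ℝ f.1) p (nilFrame k p) (nilFrame i p) :=
    ((contDiff_smoothFunctions f).contDiffAt.isSymmSndFDerivAt (by simp; norm_cast)).eq _ _
  change (nilDerivation i (nilDerivation k f)).1 p - (nilDerivation k (nilDerivation i f)).1 p =
    (heisenbergSign i k : smoothFunctions).1 p * (nilDerivation 2 f).1 p
  rw [e, e, hs, add_sub_add_left_eq_sub, ← map_sub, nilDerivation_apply]
  have hb : fderiv ℝ (nilFrame k) p (nilFrame i p) - fderiv ℝ (nilFrame i) p (nilFrame k p) =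
      (heisenbergSign i k : smoothFunctions).1 p • nilFrame 2 p := by
    rw [fderiv_nilFrame, fderiv_nilFrame]
    fin_cases i <;> fin_cases k <;> simp [nilFrame, heisenbergSign] <;> norm_num
  rw [hb, map_smul, smul_eq_mul]

theorem fderiv_eq_zero_of_nilFrame {f : ℂ × ℝ → ℝ} {p : ℂ × ℝ}
    (h : ∀ i, fderiv ℝ f p (nilFrame i p) = 0) : fderiv ℝ f p = 0 := by
  refine ContinuousLinearMap.ext fun v => ?_
  have hv : v = v.1.re • nilFrame 0 p + v.1.im • nilFrame 1 p +
      (v.2 + (p.1.im * v.1.re - p.1.re * v.1.im) / 2) • nilFrame 2 p := by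
    refine Prod.ext (Complex.ext ?_ ?_) ?_
    · simp [nilFrame]
    · simp [nilFrame]
    · simp [nilFrame]
      ring
  rw [hv]
  simp [h]

/-- The prescribed values are the frame derivatives of the linear form A x₁ + B x₂ + C x₃, and the
frame spans each tangent space. -/
theorem eq_affine_of_nilDerivation {f : smoothFunctions} {A B C : ℝ}
    (h0 : ∀ p, (nilDerivation 0 f).1 p = A - C * p.1.im / 2)
    (h1 : ∀ p, (nilDerivation 1 f).1 p = B + C * p.1.re / 2)
    (h2 : ∀ p, (nilDerivation 2 f).1 p = C) (p : ℂ × ℝ) :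
    f.1 p = A * p.1.re + B * p.1.im + C * p.2 + f.1 0 := by
  let q : ℂ × ℝ →L[ℝ] ℝ := A • Complex.reCLM.comp (ContinuousLinearMap.fst ℝ ℂ ℝ) +
    B • Complex.imCLM.comp (ContinuousLinearMap.fst ℝ ℂ ℝ) + C • ContinuousLinearMap.snd ℝ ℂ ℝ
  have hq (p : ℂ × ℝ) : q p = A * p.1.re + B * p.1.im + C * p.2 := rfl
  have hd (p : ℂ × ℝ) : HasFDerivAt (fun p => f.1 p - q p) (fderiv ℝ f.1 p - q) p :=
    (differentiable_smoothFunctions f p).hasFDerivAt.sub q.hasFDerivAt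
  have hconst := is_const_of_fderiv_eq_zero (𝕜 := ℝ) (fun p => (hd p).differentiableAt) (fun p => by
    apply fderiv_eq_zero_of_nilFrame
    intro i
    rw [(hd p).fderiv, _root_.sub_apply, ← nilDerivation_apply, hq]
    fin_cases i
    · simp [h0, nilFrame]; ring
    · simp [h1, nilFrame]; ring
    · simp [h2, nilFrame]) p 0
  simp only [map_zero] at hconst
  rw [← hq]
  linarith

/-- Every isometry of `Nil₃` is affine in the standard coordinates, and fibered over an affine map
of the plane. -/
theorem IsNilIsometry.exists_affine {g : ℂ × ℝ → ℂ × ℝ} (hg : IsNilIsometry g) :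
    ∃ (L : ℂ →L[ℝ] ℂ) (c : ℂ) (ε r : ℝ) (m : ℂ →L[ℝ] ℝ), Function.Injective L ∧
      ∀ p, g p = (L p.1 + c, ε * p.2 + m p.1 + r) := by
  have hg1 : ContDiff ℝ ∞ fun p => (g p).1 := contDiff_fst.comp hg.smooth
  let u : smoothFunctions := ⟨fun p => (g p).1.re, Complex.reCLM.contDiff.comp hg1⟩
  let w : smoothFunctions := ⟨fun p => (g p).1.im, Complex.imCLM.contDiff.comp hg1⟩
  let y : smoothFunctions := ⟨fun p => (g p).2, contDiff_snd.comp hg.smooth⟩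
  have hd (p : ℂ × ℝ) : HasFDerivAt g (fderiv ℝ g p) p :=
    (hg.smooth.differentiable (by simp) p).hasFDerivAt
  have hu (i : Fin 3) (p : ℂ × ℝ) : (fderiv ℝ g p (nilFrame i p)).1.re = (nilDerivation i u).1 p := by
    have : HasFDerivAt u.1 _ p := Complex.reCLM.hasFDerivAt.comp p (hasFDerivAt_fst.comp p (hd p))
    rw [nilDerivation_apply, this.fderiv]
    rfl
  have hw (i : Fin 3) (p : ℂ × ℝ) : (fderiv ℝ g p (nilFrame i p)).1.im = (nilDerivation i w).1 p := by
    have : HasFDerivAt w.1 _ p := Complex.imCLM.hasFDerivAt.comp p (hasFDerivAt_fst.comp p (hd p))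
    rw [nilDerivation_apply, this.fderiv]
    rfl
  have hy (i : Fin 3) (p : ℂ × ℝ) : (fderiv ℝ g p (nilFrame i p)).2 = (nilDerivation i y).1 p := by
    have : HasFDerivAt (fun p => (g p).2) _ p := hasFDerivAt_snd.comp p (hd p)
    rw [nilDerivation_apply, this.fderiv]
    rfl
  -- Column i holds the components of dg(Xᵢ) in the left-invariant frame at the image point; the
  -- metric condition is then orthogonality of O.
  let O : Matrix (Fin 3) (Fin 3) smoothFunctions := Matrix.of fun j i =>
    ![nilDerivation i u, nilDerivation i w,
      nilDerivation i y + (1 / 2 : ℝ) • (w * nilDerivation i u - u * nilDerivation i w)] j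
  have hO0 (i : Fin 3) : O 0 i = nilDerivation i u := rfl
  have hO1 (i : Fin 3) : O 1 i = nilDerivation i w := rfl
  have hO2 (i : Fin 3) (p : ℂ × ℝ) : (O 2 i).1 p = (nilDerivation i y).1 p +
      1 / 2 * (w.1 p * (nilDerivation i u).1 p - u.1 p * (nilDerivation i w).1 p) := rfl
  have horth (i k : Fin 3) (p : ℂ × ℝ) : (O 0 i).1 p * (O 0 k).1 p + (O 1 i).1 p * (O 1 k).1 p +
      (O 2 i).1 p * (O 2 k).1 p = if i = k then 1 else 0 := by
    have h1 := hg.metric p (nilFrame i p) (nilFrame k p)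
    simp only [nilMetric, nilForm, hu, hw, hy] at h1
    rw [hO0, hO0, hO1, hO1, hO2, hO2]
    rw [← nilMetric_nilFrame i k p]
    simp only [nilMetric, nilForm]
    rw [← h1]
    simp only [u, w]
    ring
  have hcoframe : IsNilCoframe nilDerivation O := by
    refine isNilCoframe_of_coordinates nilDerivation_commutator ?_ hO0 hO1 (y := y) fun i => ?_
    · ext i k p
      rw [mul_apply, Fin.sum_univ_three]
      refine (horth i k p).trans ?_
      rw [one_apply]
      split_ifs <;> rfl
    · refine Subtype.ext (funext fun p => ?_)
      change 2 * (O 2 i).1 p = 2 * (nilDerivation i y).1 p +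
        (w.1 p * (nilDerivation i u).1 p - u.1 p * (nilDerivation i w).1 p)
      rw [hO2]
      ring
  obtain ⟨n0, n1, hnn, hdet, hconst⟩ := hcoframe.rigid
  have hval (j i : Fin 3) (p : ℂ × ℝ) : (O j i).1 p = (O j i).1 0 := by
    have h (k : Fin 3) (p : ℂ × ℝ) : (nilDerivation k (O j i)).1 p = 0 := by rw [hconst]; rfl
    have := eq_affine_of_nilDerivation (A := 0) (B := 0) (C := 0) (by simpa using h 0)
      (by simpa using h 1) (h 2) p
    simpa using this
  have h20 (p : ℂ × ℝ) : (O 2 0).1 p = 0 := by rw [n0]; rfl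
  have h21 (p : ℂ × ℝ) : (O 2 1).1 p = 0 := by rw [n1]; rfl
  have h22 : (O 2 2).1 0 * (O 2 2).1 0 = 1 := congrFun (congrArg Subtype.val hnn) 0
  have hdet0 : (O 0 0).1 0 * (O 1 1).1 0 - (O 0 1).1 0 * (O 1 0).1 0 = (O 2 2).1 0 :=
    congrFun (congrArg Subtype.val hdet) 0
  have hcol := horth 2 2 0
  -- The third column is a unit vector whose last entry is ±1.
  have h02 : (O 0 2).1 0 = 0 := by
    rw [if_pos rfl] at hcol
    nlinarith [mul_self_nonneg ((O 0 2).1 0), mul_self_nonneg ((O 1 2).1 0)]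
  have h12 : (O 1 2).1 0 = 0 := by
    rw [if_pos rfl] at hcol
    nlinarith [mul_self_nonneg ((O 0 2).1 0), mul_self_nonneg ((O 1 2).1 0)]
  have dy (i : Fin 3) (p : ℂ × ℝ) : (nilDerivation i y).1 p = (O 2 i).1 0 -
      1 / 2 * (w.1 p * (O 0 i).1 0 - u.1 p * (O 1 i).1 0) := by
    rw [← hval 2 i p, hO2, ← hval 0 i p, ← hval 1 i p, hO0, hO1]
    ring
  have h20' := h20 0
  have h21' := h21 0
  obtain ⟨a1, ha1⟩ : ∃ x, x = (O 0 0).1 0 := ⟨_, rfl⟩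
  obtain ⟨a2, ha2⟩ : ∃ x, x = (O 0 1).1 0 := ⟨_, rfl⟩
  obtain ⟨b1, hb1⟩ : ∃ x, x = (O 1 0).1 0 := ⟨_, rfl⟩
  obtain ⟨b2, hb2⟩ : ∃ x, x = (O 1 1).1 0 := ⟨_, rfl⟩
  obtain ⟨ε, hε⟩ : ∃ x, x = (O 2 2).1 0 := ⟨_, rfl⟩
  have du (i : Fin 3) (p : ℂ × ℝ) : (nilDerivation i u).1 p = (O 0 i).1 0 := hval 0 i p
  have dw (i : Fin 3) (p : ℂ × ℝ) : (nilDerivation i w).1 p = (O 1 i).1 0 := hval 1 i p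
  rw [← ha1, ← ha2, ← hb1, ← hb2, ← hε] at hdet0
  rw [← hε] at h22
  have eu := eq_affine_of_nilDerivation (f := u) (A := a1) (B := a2) (C := 0)
    (fun p => by rw [du, ← ha1]; ring) (fun p => by rw [du, ← ha2]; ring) (fun p => by rw [du, h02])
  have ew := eq_affine_of_nilDerivation (f := w) (A := b1) (B := b2) (C := 0)
    (fun p => by rw [dw, ← hb1]; ring) (fun p => by rw [dw, ← hb2]; ring) (fun p => by rw [dw, h12])
  -- After substituting the affine u and w, their linear parts enter only through the determinant
  -- a₁b₂ - a₂b₁ = ε, which produces the slope C = ε.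
  have ey := eq_affine_of_nilDerivation (f := y) (A := -(1 / 2) * (w.1 0 * a1 - u.1 0 * b1))
    (B := -(1 / 2) * (w.1 0 * a2 - u.1 0 * b2)) (C := ε)
    (fun p => by
      rw [dy, h20', ew p, eu p, ← ha1, ← hb1]
      linear_combination (-(1 / 2) * p.1.im) * hdet0)
    (fun p => by
      rw [dy, h21', ew p, eu p, ← ha2, ← hb2]
      linear_combination (1 / 2 * p.1.re) * hdet0)
    (fun p => by rw [dy, h02, h12, ← hε]; ring)
  let L : ℂ →L[ℝ] ℂ := (a1 • Complex.reCLM + a2 • Complex.imCLM).smulRight (1 : ℂ) +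
    (b1 • Complex.reCLM + b2 • Complex.imCLM).smulRight Complex.I
  have hL (v : ℂ) : L v = ⟨a1 * v.re + a2 * v.im, b1 * v.re + b2 * v.im⟩ := by
    apply Complex.ext <;> simp [L]
  refine ⟨L, (g 0).1, ε, (g 0).2, (-(1 / 2) * (w.1 0 * a1 - u.1 0 * b1)) • Complex.reCLM +
    (-(1 / 2) * (w.1 0 * a2 - u.1 0 * b2)) • Complex.imCLM, ?_, fun p => ?_⟩
  · rw [injective_iff_map_eq_zero]
    intro v hv
    rw [hL] at hv
    have e1 := congrArg Complex.re hv
    have e2 := congrArg Complex.im hv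
    simp only [Complex.zero_re, Complex.zero_im] at e1 e2
    apply Complex.ext
    · simp only [Complex.zero_re]
      linear_combination (ε * b2) * e1 - (ε * a2) * e2 - (ε * v.re) * hdet0 - v.re * h22
    · simp only [Complex.zero_im]
      linear_combination (ε * a1) * e2 - (ε * b1) * e1 - (ε * v.im) * hdet0 - v.im * h22
  · have e1 : (g p).1.re = _ := eu p
    have e2 : (g p).1.im = _ := ew p
    have e3 : (g p).2 = _ := ey p
    refine Prod.ext (Complex.ext ?_ ?_) ?_
    · rw [e1, hL]; simp [u]
    · rw [e2, hL]; simp [w]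
    · rw [e3]; simp [y]; ring

/-! ### Rotations, translations and boosts of a given surface -/

namespace IsExtendedFrame

variable {U : Set ℂ} {F F' : Circle → ℂ → Matrix (Fin 2) (Fin 2) ℂ}

/-- The height of the surface in `Nil₃` is determined, up to a constant, by the surface
in Minkowski space. -/
theorem fderiv_nilSurface_snd (hF : IsExtendedFrame U F) (hU : IsOpen U) {z : ℂ} (hz : z ∈ U) :
    DifferentiableAt ℝ (fun ζ => (cmcSurface F 1 ζ).1) z ∧
    DifferentiableAt ℝ (fun ζ => (cmcSurface F 1 ζ).2) z ∧
    DifferentiableAt ℝ (fun ζ => (nilSurface F 1 ζ).2) z ∧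
    ∀ v, fderiv ℝ (fun ζ => (nilSurface F 1 ζ).2) z v =
      1 / 2 * (conj (cmcSurface F 1 z).1 * fderiv ℝ (fun ζ => (cmcSurface F 1 ζ).1) z v).im +
        fderiv ℝ (fun ζ => (cmcSurface F 1 ζ).2) z (Complex.I * v) := by
  obtain ⟨h, R, κ, H⟩ := hF.exists_surface_fderiv hU
  obtain ⟨-, -, h1, h2, h3, H⟩ := H z hz
  exact ⟨h1, h2, h3, fun v => (H v).2.2.2⟩

/-- Both Im(ζ̄ dζ) and dx₃ are invariant under ζ ↦ e^{iφ}ζ, so the two heights have the same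
differential and, U being connected, differ by a vertical translation. -/
theorem nilSurface_of_axisRotation (hF : IsExtendedFrame U F) (hF' : IsExtendedFrame U F')
    (hU : IsOpen U) (hUc : IsPreconnected U) (φ : ℝ)
    (h : ∀ z ∈ U, cmcSurface F' 1 z = axisRotation φ (cmcSurface F 1 z)) :
    ∃ a : ℂ × ℝ, ∀ z ∈ U, nilSurface F' 1 z = nilMul a (axisRotation φ (nilSurface F 1 z)) := by
  obtain ⟨c, hc⟩ := hU.exists_eq_add_of_fderiv_eq (𝕜 := ℝ) hUc
    (f := fun ζ => (nilSurface F' 1 ζ).2) (g := fun ζ => (nilSurface F 1 ζ).2)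
    (fun z hz => (hF'.fderiv_nilSurface_snd hU hz).2.2.1.differentiableWithinAt)
    (fun z hz => (hF.fderiv_nilSurface_snd hU hz).2.2.1.differentiableWithinAt) (fun z hz => by
      obtain ⟨d1, d2, -, D⟩ := hF.fderiv_nilSurface_snd hU hz
      obtain ⟨-, -, -, D'⟩ := hF'.fderiv_nilSurface_snd hU hz
      have hev := Filter.eventually_of_mem (hU.mem_nhds hz) h
      have e1 : (fun ζ => (cmcSurface F' 1 ζ).1) =ᶠ[nhds z]
          fun ζ => Complex.exp (φ * Complex.I) * (cmcSurface F 1 ζ).1 := by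
        filter_upwards [hev] with ζ hζ
        rw [hζ]; rfl
      have e2 : (fun ζ => (cmcSurface F' 1 ζ).2) =ᶠ[nhds z] fun ζ => (cmcSurface F 1 ζ).2 := by
        filter_upwards [hev] with ζ hζ
        rw [hζ]; rfl
      have hn : conj (Complex.exp (φ * Complex.I)) * Complex.exp (φ * Complex.I) = 1 := by
        rw [← Complex.normSq_eq_conj_mul_self, Complex.normSq_eq_norm_sq, Complex.norm_exp_ofReal_mul_I]
        simp
      refine ContinuousLinearMap.ext fun v => ?_
      rw [D, D', e1.fderiv_eq, e2.fderiv_eq, fderiv_const_mul d1, h z hz, axisRotation]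
      simp only [map_mul, _root_.smul_apply, smul_eq_mul]
      congr 3
      linear_combination (conj (cmcSurface F 1 z).1 *
        fderiv ℝ (fun ζ => (cmcSurface F 1 ζ).1) z v) * hn)
  refine ⟨(0, c), fun z hz => ?_⟩
  refine Prod.ext ?_ ?_
  · simp [nilMul, axisRotation, nilSurface_fst, h z hz]
  · have := hc hz
    simp only at this
    simp [nilMul, axisRotation, this, add_comm]

theorem nilSurface_of_translation (hF : IsExtendedFrame U F) (hF' : IsExtendedFrame U F')
    (hU : IsOpen U) (hUc : IsPreconnected U) (b : ℂ × ℝ)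
    (h : ∀ z ∈ U, cmcSurface F' 1 z = cmcSurface F 1 z + b) :
    ∃ a : ℂ × ℝ, ∀ z ∈ U, nilSurface F' 1 z = nilMul a (nilSurface F 1 z) := by
  -- The comparison function y + ½ Im(b̄ζ) is the height after left translation by (b₁, 0), where b₁
  -- is the horizontal part of b.
  have hd {z : ℂ} (hz : z ∈ U) := (((hF.fderiv_nilSurface_snd hU hz).2.2.1.hasFDerivAt).add
    ((Complex.imCLM.hasFDerivAt.comp z
      ((hF.fderiv_nilSurface_snd hU hz).1.hasFDerivAt.const_mul (conj b.1))).const_mul (1 / 2)))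
  obtain ⟨c, hc⟩ := hU.exists_eq_add_of_fderiv_eq (𝕜 := ℝ) hUc
    (f := fun ζ => (nilSurface F' 1 ζ).2)
    (fun z hz => (hF'.fderiv_nilSurface_snd hU hz).2.2.1.differentiableWithinAt)
    (fun z hz => (hd hz).differentiableAt.differentiableWithinAt) (fun z hz => by
      obtain ⟨d1, d2, -, D⟩ := hF.fderiv_nilSurface_snd hU hz
      obtain ⟨-, -, -, D'⟩ := hF'.fderiv_nilSurface_snd hU hz
      have hev := Filter.eventually_of_mem (hU.mem_nhds hz) h
      have e1 : (fun ζ => (cmcSurface F' 1 ζ).1) =ᶠ[nhds z]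
          fun ζ => (cmcSurface F 1 ζ).1 + b.1 := by
        filter_upwards [hev] with ζ hζ
        rw [hζ]; rfl
      have e2 : (fun ζ => (cmcSurface F' 1 ζ).2) =ᶠ[nhds z]
          fun ζ => (cmcSurface F 1 ζ).2 + b.2 := by
        filter_upwards [hev] with ζ hζ
        rw [hζ]; rfl
      refine ContinuousLinearMap.ext fun v => ?_
      rw [(hd hz).fderiv, D', e1.fderiv_eq, e2.fderiv_eq, fderiv_add_const, fderiv_add_const, h z hz]
      simp only [_root_.smul_apply, _root_.add_apply, ContinuousLinearMap.comp_apply, smul_eq_mul,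
        Complex.imCLM_apply, D, Prod.fst_add, map_add, add_mul, Complex.add_im]
      ring)
  refine ⟨(b.1, c), fun z hz => ?_⟩
  refine Prod.ext ?_ ?_
  · simp [nilMul, nilSurface_fst, h z hz, add_comm]
  · have := hc hz
    simp only [Pi.add_apply, Function.comp_apply, Complex.imCLM_apply] at this
    simp only [nilMul, this, nilSurface_fst, Complex.mul_im, Complex.conj_re, Complex.conj_im]
    ring

/-- The surface in Minkowski space is not contained in a non-vertical plane. -/
theorem not_planar (hF : IsExtendedFrame U F) (hU : IsOpen U) (hne : U.Nonempty) (m : ℂ) (r : ℝ) :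
    ¬ ∀ z ∈ U, (cmcSurface F 1 z).2 = (conj m * (cmcSurface F 1 z).1).re + r := by
  intro hpl
  obtain ⟨h, R, κ, H⟩ := hF.exists_surface_fderiv hU
  -- The differential of x₃ - Re(m̄ζ) is h·Im(q·v), where q is this quadratic form in the first
  -- column, using c = b̄; its vanishing for all v gives q = 0.
  have quad : ∀ z ∈ U, 2 * F 1 z 0 0 * F 1 z 1 0 - conj m * F 1 z 0 0 ^ 2 - m * F 1 z 1 0 ^ 2 = 0 := by
    intro z hz
    obtain ⟨hpos, -, d1, -, -, H⟩ := H z hz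
    have e2 : (fun ζ => (cmcSurface F 1 ζ).2) =ᶠ[nhds z]
        fun ζ => Complex.reCLM (conj m * (cmcSurface F 1 ζ).1) + r := by
      filter_upwards [hU.mem_nhds hz] with ζ hζ
      exact hpl ζ hζ
    have hd := (Complex.reCLM.hasFDerivAt.comp z (d1.hasFDerivAt.const_mul (conj m))).add_const r
    have key (v : ℂ) : ((2 * F 1 z 0 0 * F 1 z 1 0 - conj m * F 1 z 0 0 ^ 2 -
        m * F 1 z 1 0 ^ 2) * v).im = 0 := by
      obtain ⟨-, D1, D2, -⟩ := H v
      rw [(hF.mem_SU11 1 z hz).entries.1]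
      rw [e2.fderiv_eq] at D2
      have h3 := DFunLike.congr_fun hd.fderiv v
      simp only [Function.comp_def] at h3
      rw [h3] at D2
      simp only [ContinuousLinearMap.comp_apply, _root_.smul_apply, smul_eq_mul, D1,
        Complex.reCLM_apply] at D2
      have hh : h z ≠ 0 := hpos.ne'
      have h4 : h z * ((2 * F 1 z 0 0 * conj (F 1 z 0 1) - conj m * F 1 z 0 0 ^ 2 -
        m * conj (F 1 z 0 1) ^ 2) * v).im = 0 := by
        simp only [Complex.mul_re, Complex.mul_im, Complex.sub_re, Complex.sub_im, Complex.conj_re,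
          Complex.conj_im, Complex.ofReal_re, Complex.ofReal_im, Complex.I_re, Complex.I_im,
          Complex.neg_re, Complex.neg_im, pow_two, Complex.re_ofNat, Complex.im_ofNat] at D2 ⊢
        linear_combination -D2
      exact (mul_eq_zero.mp h4).resolve_left hh
    apply Complex.ext
    · simpa using key Complex.I
    · simpa using key 1
  obtain ⟨z, hz⟩ := hne
  obtain ⟨hpos, dF, -, -, -, H⟩ := H z hz
  obtain ⟨h10, h11, hdet⟩ := (hF.mem_SU11 1 z hz).entries
  have hd := ((((dF 0).hasFDerivAt.const_mul 2).mul (dF 1).hasFDerivAt).sub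
    (((dF 0).hasFDerivAt.pow 2).const_mul (conj m))).sub (((dF 1).hasFDerivAt.pow 2).const_mul m)
  have hzero := hd.unique ((hasFDerivAt_const (0 : ℂ) z).congr_of_eventuallyEq
    (Filter.eventually_of_mem (hU.mem_nhds hz) quad))
  have q := quad z hz
  -- Differentiating q = 0 leaves, modulo q itself, the polarization of q between the two columns of
  -- the frame.
  have D (v : ℂ) : (R z * v + Complex.I / 4 * h z * conj v) *
      (F 1 z 0 1 * F 1 z 1 0 + F 1 z 0 0 * F 1 z 1 1 - conj m * F 1 z 0 0 * F 1 z 0 1 -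
        m * F 1 z 1 0 * F 1 z 1 1) = 0 := by
    have h1 := DFunLike.congr_fun hzero v
    simp only [_root_.sub_apply, _root_.add_apply, _root_.smul_apply, smul_eq_mul, _root_.zero_apply,
      (H v).1, nsmul_eq_mul] at h1
    push_cast at h1
    linear_combination h1 / 2 - κ z v * q
  have D1 := D 1
  have DI := D Complex.I
  simp only [map_one, Complex.conj_I] at D1 DI
  have hZ : F 1 z 0 1 * F 1 z 1 0 + F 1 z 0 0 * F 1 z 1 1 - conj m * F 1 z 0 0 * F 1 z 0 1 -
        m * F 1 z 1 0 * F 1 z 1 1 = 0 := by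
    -- The combination of v = 1 and v = i removes R and isolates the coefficient of v̄, which is
    -- nonzero since h > 0.
    have h1 : (Complex.I / 2 * h z) * (F 1 z 0 1 * F 1 z 1 0 + F 1 z 0 0 * F 1 z 1 1 -
        conj m * F 1 z 0 0 * F 1 z 0 1 - m * F 1 z 1 0 * F 1 z 1 1) = 0 := by
      linear_combination D1 + Complex.I * DI - (R z - Complex.I / 4 * h z) *
        (F 1 z 0 1 * F 1 z 1 0 + F 1 z 0 0 * F 1 z 1 1 -
        conj m * F 1 z 0 0 * F 1 z 0 1 - m * F 1 z 1 0 * F 1 z 1 1) * Complex.I_sq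
    refine (mul_eq_zero.mp h1).resolve_left ?_
    have : (h z : ℂ) ≠ 0 := by exact_mod_cast hpos.ne'
    simp [this]
  -- The first column is q-orthogonal to both columns, which form a basis, so it lies in the kernel
  -- of q: a = mc and c = m̄a. Conjugating the latter gives b = md, whence ad - bc = 0.
  have ha : F 1 z 0 0 = m * F 1 z 1 0 := by
    linear_combination F 1 z 0 0 * hZ - F 1 z 0 1 * q - (F 1 z 0 0 - m * F 1 z 1 0) * hdet
  have hc : F 1 z 1 0 = conj m * F 1 z 0 0 := by
    linear_combination -F 1 z 1 0 * hZ + F 1 z 1 1 * q - (F 1 z 1 0 - conj m * F 1 z 0 0) * hdet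
  have hc' := congrArg conj hc
  rw [map_mul, Complex.conj_conj, h10, Complex.conj_conj, ← h11] at hc'
  rw [hc', ha] at hdet
  have : (0 : ℂ) = 1 := by linear_combination hdet
  exact zero_ne_one this

theorem not_congruent_of_lorentzBoost (hF : IsExtendedFrame U F) (hU : IsOpen U) (hne : U.Nonempty)
    {φ t : ℝ} (ht : t ≠ 0)
    (h : ∀ z ∈ U, cmcSurface F' 1 z = lorentzBoost φ t (cmcSurface F 1 z)) :
    ¬ ∃ g : ℂ × ℝ → ℂ × ℝ, IsNilIsometry g ∧
      ∀ z ∈ U, nilSurface F' 1 z = g (nilSurface F 1 z) := by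
  rintro ⟨g, hg, hgU⟩
  obtain ⟨L, c, _, _, _, -, hL⟩ := hg.exists_affine
  have hs : Real.sinh t ≠ 0 := by simpa using ht
  obtain ⟨u, hu⟩ : ∃ u, u = Complex.exp (φ * Complex.I) := ⟨_, rfl⟩
  have hn : u.re * u.re + u.im * u.im = 1 := by
    have : Complex.normSq u = 1 := by
      rw [hu, Complex.normSq_eq_norm_sq, Complex.norm_exp_ofReal_mul_I]; simp
    rwa [Complex.normSq_apply] at this
  refine hF.not_planar hU hne
    -- These coefficients solve s cosh t + x₃ sinh t = Re(ū(Lζ + c)), the component along the boost,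
    -- for x₃; this is where sinh t ≠ 0 is needed.
    ⟨((conj u * L 1).re - Real.cosh t * u.re) / Real.sinh t,
      ((conj u * L Complex.I).re - Real.cosh t * u.im) / Real.sinh t⟩
    ((conj u * c).re / Real.sinh t) fun z hz => ?_
  have h1 := congrArg Prod.fst (hgU z hz)
  rw [hL, nilSurface_fst, nilSurface_fst, h z hz, lorentzBoost, ← hu] at h1
  obtain ⟨x, hx⟩ : ∃ x, x = (cmcSurface F 1 z).1 := ⟨_, rfl⟩
  rw [← hx] at h1 ⊢
  have hLx : L x = x.re • L 1 + x.im • L Complex.I := by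
    rw [← map_smul, ← map_smul, ← map_add]
    congr 1
    simp [Complex.re_add_im]
  simp only [hLx] at h1
  have hre := congrArg Complex.re h1
  have him := congrArg Complex.im h1
  simp only [Complex.add_re, Complex.add_im, Complex.mul_re, Complex.mul_im, Complex.conj_re,
    Complex.conj_im, Complex.ofReal_re, Complex.ofReal_im, Complex.real_smul] at hre him ⊢
  field_simp
  linear_combination u.re * hre + u.im * him - ((Real.cosh t - 1) * (u.re * x.re + u.im * x.im) +
    Real.sinh t * (cmcSurface F 1 z).2) * hn

end IsExtendedFrame

/-! ### Tilted hyperbolic cylinders -/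

/-- The one-parameter subgroup of `SU(1,1)` with off-diagonal generator `(0 y; ȳ 0)`. -/
noncomputable def hyperbolicRotation (y : ℂ) (r : ℝ) : Matrix (Fin 2) (Fin 2) ℂ :=
  !![(Real.cosh r : ℂ), y * (Real.sinh r : ℂ); conj y * (Real.sinh r : ℂ), (Real.cosh r : ℂ)]

theorem isSU11_hyperbolicRotation {y : ℂ} (hy : y * conj y = 1) (r : ℝ) :
    IsSU11 (hyperbolicRotation y r) := by
  have h : (Real.cosh r : ℂ) ^ 2 - (Real.sinh r : ℂ) ^ 2 = 1 := by
    exact_mod_cast Real.cosh_sq_sub_sinh_sq r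
  constructor
  · ext i j
    fin_cases i <;> fin_cases j <;>
      simp [hyperbolicRotation, pauli₃, mul_apply, Fin.sum_univ_two, -Complex.ofReal_cosh, -Complex.ofReal_sinh]
    · linear_combination h - (Real.sinh r : ℂ) ^ 2 * hy
    · ring
    · ring
    · linear_combination -h + (Real.sinh r : ℂ) ^ 2 * hy
  · simp [hyperbolicRotation, det_fin_two, -Complex.ofReal_cosh, -Complex.ofReal_sinh]
    linear_combination h - (Real.sinh r : ℂ) ^ 2 * hy

theorem IsSU11.mul {M N : Matrix (Fin 2) (Fin 2) ℂ} (hM : IsSU11 M) (hN : IsSU11 N) :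
    IsSU11 (M * N) := by
  refine ⟨?_, by rw [det_mul, hM.2, hN.2, one_mul]⟩
  calc (M * N)ᴴ * pauli₃ * (M * N) = Nᴴ * (Mᴴ * pauli₃ * M) * N := by
        simp only [conjTranspose_mul, Matrix.mul_assoc]
    _ = pauli₃ := by rw [hM.1, hN.1]

theorem pauli₃_mul_self : pauli₃ * pauli₃ = 1 := by
  simp [pauli₃, one_fin_two]

theorem hyperbolicRotation_neg (y : ℂ) (r : ℝ) :
    hyperbolicRotation y (-r) = pauli₃ * hyperbolicRotation y r * pauli₃ := by
  simp [hyperbolicRotation, pauli₃]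

/-- The extended frame of a hyperbolic cylinder ruled in the direction `e^{iφ}`, tilted by a boost of
rapidity `t` in this direction. -/
noncomputable def cylinderFrame (φ t : ℝ) (l : Circle) (z : ℂ) : Matrix (Fin 2) (Fin 2) ℂ :=
  hyperbolicRotation (Complex.exp (φ * Complex.I)) (t / 2 * (l : ℂ).re) *
    hyperbolicRotation (-Complex.I * Complex.exp (φ * Complex.I))
      (2 * (Complex.exp (-(φ * Complex.I)) * (l : ℂ)⁻¹ * z).re)

theorem exp_mul_I_mul_conj (φ : ℝ) :
    Complex.exp (φ * Complex.I) * conj (Complex.exp (φ * Complex.I)) = 1 := by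
  rw [Complex.mul_conj, Complex.normSq_eq_norm_sq, Complex.norm_exp_ofReal_mul_I]
  simp

theorem conj_exp_mul_I (φ : ℝ) :
    conj (Complex.exp (φ * Complex.I)) = Complex.exp (-(φ * Complex.I)) := by
  rw [← Complex.exp_conj]; simp

theorem neg_I_mul_mul_conj {u : ℂ} (hu : u * conj u = 1) :
    (-Complex.I * u) * conj (-Complex.I * u) = 1 := by
  simp only [map_mul, map_neg, Complex.conj_I]
  linear_combination (-(Complex.I ^ 2)) * hu - Complex.I_sq

theorem isSU11_cylinderFrame (φ t : ℝ) (l : Circle) (z : ℂ) : IsSU11 (cylinderFrame φ t l z) :=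
  (isSU11_hyperbolicRotation (exp_mul_I_mul_conj φ) _).mul
    (isSU11_hyperbolicRotation (neg_I_mul_mul_conj (exp_mul_I_mul_conj φ)) _)

theorem hasDerivAt_hyperbolicRotation {y : ℂ} (hy : y * conj y = 1) (r : ℝ) (i j : Fin 2) :
    HasDerivAt (fun r => hyperbolicRotation y r i j)
      ((hyperbolicRotation y r * !![0, y; conj y, 0]) i j) r := by
  have hc := (Real.hasDerivAt_cosh r).ofReal_comp
  have hs := (Real.hasDerivAt_sinh r).ofReal_comp
  fin_cases i <;> fin_cases j
  · refine hc.congr_deriv ?_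
    simp [hyperbolicRotation, mul_apply, Fin.sum_univ_two]
    linear_combination (-Complex.sinh r) * hy
  · refine (hs.const_mul y).congr_deriv ?_
    simp [hyperbolicRotation, mul_apply, Fin.sum_univ_two]
    ring
  · refine (hs.const_mul (conj y)).congr_deriv ?_
    simp [hyperbolicRotation, mul_apply, Fin.sum_univ_two]
    ring
  · refine hc.congr_deriv ?_
    simp [hyperbolicRotation, mul_apply, Fin.sum_univ_two]
    linear_combination (-Complex.sinh r) * hy

theorem hasFDerivAt_mul_hyperbolicRotation (A : Matrix (Fin 2) (Fin 2) ℂ) {y : ℂ} (hy : y * conj y = 1)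
    (w z : ℂ) (i j : Fin 2) :
    HasFDerivAt (fun ζ => (A * hyperbolicRotation y (2 * (w * ζ).re)) i j)
      (((2 : ℝ) • Complex.reCLM.comp (w • ContinuousLinearMap.id ℝ ℂ)).smulRight
        ((A * hyperbolicRotation y (2 * (w * z).re) * !![0, y; conj y, 0]) i j)) z := by
  set τ : ℂ →L[ℝ] ℝ := (2 : ℝ) • Complex.reCLM.comp (w • ContinuousLinearMap.id ℝ ℂ) with hτ
  have hd : HasFDerivAt (fun ζ => 2 * (w * ζ).re) τ z := τ.hasFDerivAt
  have h (k : Fin 2) := ((hasDerivAt_hyperbolicRotation hy (2 * (w * z).re) k j).hasFDerivAt.comp z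
    hd).const_mul (A i k)
  refine (((h 0).add (h 1)).congr_of_eventuallyEq (Filter.Eventually.of_forall fun ζ => ?_)).congr_fderiv
    (ContinuousLinearMap.ext fun v => ?_)
  · simp only [mul_apply, Fin.sum_univ_two]; rfl
  · rw [Matrix.mul_assoc]
    simp only [mul_apply (M := A), Fin.sum_univ_two]
    simp only [_root_.add_apply, _root_.smul_apply, ContinuousLinearMap.comp_apply,
      ContinuousLinearMap.smulRight_apply, ContinuousLinearMap.toSpanSingleton_apply, smul_eq_mul,
      Complex.real_smul]
    ring

theorem contDiff_frameEntry_cylinderFrame (φ t : ℝ) (i j : Fin 2) :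
    ContDiff ℝ ∞ (fun p : ℝ × ℂ => cylinderFrame φ t (Circle.exp p.1) p.2 i j) := by
  have h1 : ContDiff ℝ ∞ fun p : ℝ × ℂ => t / 2 * ((Circle.exp p.1 : Circle) : ℂ).re := by
    have : ContDiff ℝ ∞ fun p : ℝ × ℂ => Complex.exp ((p.1 : ℂ) * Complex.I) :=
      ((Complex.ofRealCLM.contDiff.comp contDiff_fst).mul contDiff_const).cexp
    exact contDiff_const.mul (Complex.reCLM.contDiff.comp (by simpa only [Circle.coe_exp] using this))
  have h2 : ContDiff ℝ ∞ fun p : ℝ × ℂ =>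
      2 * (Complex.exp (-(φ * Complex.I)) * ((Circle.exp p.1 : Circle) : ℂ)⁻¹ * p.2).re := by
    have : ContDiff ℝ ∞ fun p : ℝ × ℂ => Complex.exp (-((p.1 : ℂ) * Complex.I)) :=
      ((Complex.ofRealCLM.contDiff.comp contDiff_fst).mul contDiff_const).neg.cexp
    exact contDiff_const.mul (Complex.reCLM.contDiff.comp ((contDiff_const.mul
      (by simpa only [Circle.coe_exp, ← Complex.exp_neg] using this)).mul contDiff_snd))
  have hyp {y : ℂ} {r : ℝ × ℂ → ℝ} (hr : ContDiff ℝ ∞ r) (i j : Fin 2) :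
      ContDiff ℝ ∞ fun p => hyperbolicRotation y (r p) i j := by
    have hc : ContDiff ℝ ∞ fun p => (Real.cosh (r p) : ℂ) := Complex.ofRealCLM.contDiff.comp hr.cosh
    have hs : ContDiff ℝ ∞ fun p => (Real.sinh (r p) : ℂ) := Complex.ofRealCLM.contDiff.comp hr.sinh
    fin_cases i <;> fin_cases j
    · exact hc
    · exact contDiff_const.mul hs
    · exact contDiff_const.mul hs
    · exact hc
  simp only [cylinderFrame, mul_apply, Fin.sum_univ_two]
  exact ((hyp h1 i 0).mul (hyp h2 0 j)).add ((hyp h1 i 1).mul (hyp h2 1 j))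

/-- The left factor is independent of z, so the Maurer-Cartan form is the constant generator of the
right factor times d(2 Re(wz)) = w dz + w̄ dz̄, with w = e^{-iφ}λ⁻¹. Both arguments are odd in λ,
which gives the twisting. -/
theorem isExtendedFrame_cylinderFrame (U : Set ℂ) (φ t : ℝ) :
    IsExtendedFrame U (cylinderFrame φ t) := by
  refine ⟨fun i j => (contDiff_frameEntry_cylinderFrame φ t i j).contDiffOn,
    fun l z _ => isSU11_cylinderFrame φ t l z, fun l z _ => ?_, ?_⟩
  · have hl : ((Circle.exp Real.pi * l : Circle) : ℂ) = -l := by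
      simp [Circle.coe_exp, Complex.exp_pi_mul_I]
    simp only [cylinderFrame, hl]
    have e1 : t / 2 * (-(l : ℂ)).re = -(t / 2 * (l : ℂ).re) := by simp
    have e2 : 2 * (Complex.exp (-(φ * Complex.I)) * (-(l : ℂ))⁻¹ * z).re =
        -(2 * (Complex.exp (-(φ * Complex.I)) * (l : ℂ)⁻¹ * z).re) := by
      rw [inv_neg, mul_neg, neg_mul, Complex.neg_re, mul_neg]
    rw [e1, e2, hyperbolicRotation_neg, hyperbolicRotation_neg]
    simp only [Matrix.mul_assoc]
    rw [← Matrix.mul_assoc pauli₃ pauli₃, pauli₃_mul_self, Matrix.one_mul]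
  · refine ⟨fun _ => 4, fun _ => -Complex.exp (-(φ * Complex.I)) ^ 2, contDiffOn_const,
      fun _ _ => by norm_num, differentiableOn_const _, fun l z _ => ?_⟩
    have hu := exp_mul_I_mul_conj φ
    have hc := conj_exp_mul_I φ
    have hy := neg_I_mul_mul_conj hu
    have key (v : ℂ) (i j : Fin 2) : fderiv ℝ (fun ζ => cylinderFrame φ t l ζ i j) z v =
        ((2 * (Complex.exp (-(φ * Complex.I)) * (l : ℂ)⁻¹ * v).re : ℝ) : ℂ) * (cylinderFrame φ t l z *
          !![0, -Complex.I * Complex.exp (φ * Complex.I);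
            conj (-Complex.I * Complex.exp (φ * Complex.I)), 0]) i j := by
      have := (hasFDerivAt_mul_hyperbolicRotation
        (hyperbolicRotation (Complex.exp (φ * Complex.I)) (t / 2 * (l : ℂ).re)) hy
        (Complex.exp (-(φ * Complex.I)) * (l : ℂ)⁻¹) z i j).fderiv
      simp only [cylinderFrame]
      rw [this]
      rfl
    have hw : conj (Complex.exp (-(φ * Complex.I)) * (l : ℂ)⁻¹) = Complex.exp (φ * Complex.I) * l := by
      rw [map_mul, ← hc, Complex.conj_conj, ← Circle.coe_inv, ← Circle.coe_inv_eq_conj, inv_inv]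
    obtain ⟨w, hwdef⟩ : ∃ w, w = Complex.exp (-(φ * Complex.I)) * (l : ℂ)⁻¹ := ⟨_, rfl⟩
    rw [← hwdef] at hw
    rw [← hwdef] at key
    have hwz (i j : Fin 2) : wirtinger (fun ζ => cylinderFrame φ t l ζ i j) z = w * (cylinderFrame φ t l z *
          !![0, -Complex.I * Complex.exp (φ * Complex.I);
            conj (-Complex.I * Complex.exp (φ * Complex.I)), 0]) i j := by
      have e : (((2 * (w * 1).re : ℝ) : ℂ) - Complex.I * ((2 * (w * Complex.I).re : ℝ) : ℂ)) / 2 = w := by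
        conv_rhs => rw [← Complex.re_add_im w]
        simp only [mul_one, Complex.mul_I_re]
        push_cast
        ring
      rw [wirtinger, key, key]
      linear_combination (cylinderFrame φ t l z *
          !![0, -Complex.I * Complex.exp (φ * Complex.I);
            conj (-Complex.I * Complex.exp (φ * Complex.I)), 0]) i j * e
    have hwzb (i j : Fin 2) : wirtingerBar (fun ζ => cylinderFrame φ t l ζ i j) z =
        conj w * (cylinderFrame φ t l z *
          !![0, -Complex.I * Complex.exp (φ * Complex.I);
            conj (-Complex.I * Complex.exp (φ * Complex.I)), 0]) i j := by
      have : conj w = w.re - w.im * Complex.I := by apply Complex.ext <;> simp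
      rw [wirtingerBar, key, key, this]
      simp
      ring
    have w0 : wirtinger (fun _ => ((4 : ℝ) : ℂ)) z = 0 := by simp [wirtinger]
    have w1 : wirtingerBar (fun _ => ((4 : ℝ) : ℂ)) z = 0 := by simp [wirtingerBar]
    have hu' : Complex.exp (φ * Complex.I) * Complex.exp (-(φ * Complex.I)) = 1 := by rw [← hc, hu]
    obtain ⟨u, hu1⟩ : ∃ u, u = Complex.exp (φ * Complex.I) := ⟨_, rfl⟩
    obtain ⟨u', hu2⟩ : ∃ u', u' = Complex.exp (-(φ * Complex.I)) := ⟨_, rfl⟩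
    have hDI : Complex.I / 4 * ((4 : ℝ) : ℂ) = Complex.I := by push_cast; ring
    constructor
    · have e : w • !![0, -Complex.I * u; conj (-Complex.I * u), 0] =
          frameU (fun _ => 4) (fun _ => -u' ^ 2) l z := by
        rw [frameU, w0, hDI, hwdef, map_mul, hu1, hc, ← hu1, ← hu2]
        rw [← hu1, ← hu2] at hu'
        ext i j
        fin_cases i <;> fin_cases j <;> simp
        · linear_combination ((l : ℂ)⁻¹ * Complex.I) * hu'
        · ring
      rw [← hu2, ← e, Matrix.mul_smul]
      ext i j
      rw [of_apply, hwz, ← hu1, Matrix.smul_apply, smul_eq_mul]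
    · have e : conj w • !![0, -Complex.I * u; conj (-Complex.I * u), 0] =
          frameV (fun _ => 4) (fun _ => -u' ^ 2) l z := by
        have hcu : conj u' = u := by rw [hu2, ← hc, Complex.conj_conj, hu1]
        rw [frameV, w1, hDI, hw, map_mul, hu1, hc, ← hu1, ← hu2]
        rw [← hu1, ← hu2] at hu'
        ext i j
        fin_cases i <;> fin_cases j <;> simp [hcu]
        · ring
        · linear_combination ((l : ℂ) * Complex.I) * hu'
      rw [← hu2, ← e, Matrix.mul_smul]
      ext i j
      rw [of_apply, hwzb, ← hu1, Matrix.smul_apply, smul_eq_mul]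

/-- Re λ is stationary at λ = 1, so the tilting factor does not contribute. It therefore acts on the
Sym formula by conjugation alone, as a boost without translation. -/
theorem loopDeriv_cylinderFrame (φ t : ℝ) (z : ℂ) (i j : Fin 2) :
    loopDeriv (fun m => cylinderFrame φ t m z) 1 i j =
      2 * ((Complex.exp (-(φ * Complex.I)) * z).im : ℂ) * (cylinderFrame φ t 1 z *
        !![0, -Complex.I * Complex.exp (φ * Complex.I);
          conj (-Complex.I * Complex.exp (φ * Complex.I)), 0]) i j := by
  rw [← Circle.exp_zero, loopDeriv_circleExp]
  have hu := exp_mul_I_mul_conj φ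
  have h1 : HasDerivAt (fun r : ℝ => t / 2 * ((Circle.exp r : Circle) : ℂ).re) 0 0 := by
    have := (Real.hasDerivAt_cos 0).const_mul (t / 2)
    simpa [Circle.coe_exp, Complex.exp_ofReal_mul_I_re] using this
  have h2 : HasDerivAt (fun r : ℝ => 2 * (Complex.exp (-(φ * Complex.I)) *
      ((Circle.exp r : Circle) : ℂ)⁻¹ * z).re) (2 * (Complex.exp (-(φ * Complex.I)) * z).im) 0 := by
    have h3 := (((hasDerivAt_exp_neg_mul_I 0).const_mul (Complex.exp (-(φ * Complex.I)))).mul_const z)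
    have h4 := (Complex.reCLM.hasFDerivAt.comp_hasDerivAt 0 h3).const_mul 2
    refine (h4.congr_of_eventuallyEq (Filter.Eventually.of_forall fun r => ?_)).congr_deriv ?_
    · simp only [Circle.coe_exp, Complex.exp_neg]
      rfl
    · have : Complex.exp (-(φ * Complex.I)) * -(Complex.exp (-(((0 : ℝ) : ℂ) * Complex.I)) * Complex.I) * z =
          -((Complex.exp (-(φ * Complex.I)) * z) * Complex.I) := by
        simp only [Complex.ofReal_zero, zero_mul, neg_zero, Complex.exp_zero]
        ring
      rw [this, Complex.reCLM_apply, Complex.neg_re, Complex.mul_I_re, neg_neg]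
  have hA (k : Fin 2) := (hasDerivAt_hyperbolicRotation hu
    (t / 2 * ((Circle.exp 0 : Circle) : ℂ).re) i k).scomp 0 h1
  have hB (k : Fin 2) := (hasDerivAt_hyperbolicRotation (neg_I_mul_mul_conj hu)
    (2 * (Complex.exp (-(φ * Complex.I)) * ((Circle.exp 0 : Circle) : ℂ)⁻¹ * z).re) k j).scomp 0 h2
  have h := ((hA 0).mul (hB 0)).add ((hA 1).mul (hB 1))
  have h' := h.congr_of_eventuallyEq (f₁ := fun r : ℝ => cylinderFrame φ t (Circle.exp r) z i j)
    (Filter.Eventually.of_forall fun r => by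
      simp only [cylinderFrame, mul_apply, Fin.sum_univ_two]; rfl)
  rw [h'.deriv]
  simp only [cylinderFrame, zero_smul, zero_mul, zero_add, Function.comp_apply, Complex.real_smul]
  rw [Matrix.mul_assoc]
  rw [mul_apply (M := hyperbolicRotation (Complex.exp (φ * Complex.I)) _), Fin.sum_univ_two]
  push_cast
  ring

/-- The surface in Minkowski space given by `cylinderFrame`. -/
theorem cmcSurface_cylinderFrame (φ t : ℝ) (z : ℂ) :
    cmcSurface (cylinderFrame φ t) 1 z =
      (Complex.exp (φ * Complex.I) *
        ⟨4 * Real.cosh t * (Complex.exp (-(φ * Complex.I)) * z).im +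
            Real.sinh t * Real.cosh (4 * (Complex.exp (-(φ * Complex.I)) * z).re),
          -Real.sinh (4 * (Complex.exp (-(φ * Complex.I)) * z).re)⟩,
        4 * Real.sinh t * (Complex.exp (-(φ * Complex.I)) * z).im +
            Real.cosh t * Real.cosh (4 * (Complex.exp (-(φ * Complex.I)) * z).re)) := by
  have hu := exp_mul_I_mul_conj φ
  obtain ⟨h10, h11, hdet⟩ := (isSU11_cylinderFrame φ t 1 z).entries
  obtain ⟨x, hx⟩ : ∃ x, x = (Complex.exp (-(φ * Complex.I)) * z).re := ⟨_, rfl⟩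
  obtain ⟨y, hy⟩ : ∃ y, y = (Complex.exp (-(φ * Complex.I)) * z).im := ⟨_, rfl⟩
  have h00 : cylinderFrame φ t 1 z 0 0 = Real.cosh (t / 2) * Real.cosh (2 * x) +
      Complex.I * (Real.sinh (t / 2) * Real.sinh (2 * x)) := by
    simp only [cylinderFrame, hyperbolicRotation, mul_apply, Fin.sum_univ_two, of_apply, cons_val',
      cons_val_zero, cons_val_one, cons_val_fin_one, Circle.coe_one, inv_one, mul_one, Complex.one_re, ← hx,
      map_mul, map_neg, Complex.conj_I]
    linear_combination (Complex.I * (Real.sinh (t / 2) * Real.sinh (2 * x))) * hu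
  have h01 : cylinderFrame φ t 1 z 0 1 = Complex.exp (φ * Complex.I) *
      (Real.sinh (t / 2) * Real.cosh (2 * x) - Complex.I * (Real.cosh (t / 2) * Real.sinh (2 * x))) := by
    simp only [cylinderFrame, hyperbolicRotation, mul_apply, Fin.sum_univ_two, of_apply, cons_val',
      cons_val_zero, cons_val_one, cons_val_fin_one, Circle.coe_one, inv_one, mul_one, Complex.one_re, ← hx]
    ring
  have e01 : symMatrix (cylinderFrame φ t) 1 z 0 1 =
      2 * y * Complex.I * (Complex.exp (φ * Complex.I) * (cylinderFrame φ t 1 z 0 0) ^ 2 +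
        conj (Complex.exp (φ * Complex.I)) * cylinderFrame φ t 1 z 0 1 ^ 2) +
      Complex.I * cylinderFrame φ t 1 z 0 0 * cylinderFrame φ t 1 z 0 1 := by
    simp only [symMatrix, symNormal, inv_fin_two_of_det_eq_one hdet, Matrix.sub_apply, Matrix.neg_apply,
      Matrix.smul_apply, mul_apply, Fin.sum_univ_two, loopDeriv_cylinderFrame, pauli₃, of_apply, cons_val',
      cons_val_zero, cons_val_one, cons_val_fin_one, smul_eq_mul, ← hy, map_mul, map_neg, Complex.conj_I]
    ring
  have e00 : symMatrix (cylinderFrame φ t) 1 z 0 0 =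
      -(2 * y * Complex.I * (conj (Complex.exp (φ * Complex.I)) * cylinderFrame φ t 1 z 0 1 *
        conj (cylinderFrame φ t 1 z 0 0) + Complex.exp (φ * Complex.I) * cylinderFrame φ t 1 z 0 0 *
        conj (cylinderFrame φ t 1 z 0 1))) - Complex.I / 2 * (cylinderFrame φ t 1 z 0 0 *
        conj (cylinderFrame φ t 1 z 0 0) + cylinderFrame φ t 1 z 0 1 *
        conj (cylinderFrame φ t 1 z 0 1)) := by
    simp only [symMatrix, symNormal, inv_fin_two_of_det_eq_one hdet, Matrix.sub_apply, Matrix.neg_apply,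
      Matrix.smul_apply, mul_apply, Fin.sum_univ_two, loopDeriv_cylinderFrame, pauli₃, of_apply, cons_val',
      cons_val_zero, cons_val_one, cons_val_fin_one, smul_eq_mul, ← hy, map_mul, map_neg, Complex.conj_I]
    rw [h10, h11]
    ring
  -- Conjugation by the frame doubles the arguments t/2 and 2x, hence the double-argument formulas.
  have ct : Real.cosh t = Real.cosh (t / 2) ^ 2 + Real.sinh (t / 2) ^ 2 := by
    rw [← Real.cosh_two_mul]; congr 1; ring
  have st : Real.sinh t = 2 * Real.sinh (t / 2) * Real.cosh (t / 2) := by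
    rw [← Real.sinh_two_mul]; congr 1; ring
  have cx : Real.cosh (4 * x) = Real.cosh (2 * x) ^ 2 + Real.sinh (2 * x) ^ 2 := by
    rw [← Real.cosh_two_mul]; congr 1; ring
  have sx : Real.sinh (4 * x) = 2 * Real.sinh (2 * x) * Real.cosh (2 * x) := by
    rw [← Real.sinh_two_mul]; congr 1; ring
  have pt := Real.cosh_sq_sub_sinh_sq (t / 2)
  have px := Real.cosh_sq_sub_sinh_sq (2 * x)
  rw [cmcSurface, suCoord_eq, e01, e00, h00, h01, ← hx, ← hy, ct, st, cx, sx]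
  generalize Complex.exp (φ * Complex.I) = u at hu ⊢
  generalize Real.cosh (t / 2) = a at *
  generalize Real.sinh (t / 2) = b at *
  generalize Real.cosh (2 * x) = c at *
  generalize Real.sinh (2 * x) = d at *
  have pt' : (a : ℂ) ^ 2 - (b : ℂ) ^ 2 = 1 := by exact_mod_cast pt
  have px' : (c : ℂ) ^ 2 - (d : ℂ) ^ 2 = 1 := by exact_mod_cast px
  have hmk (p q : ℝ) : (⟨p, q⟩ : ℂ) = p + q * Complex.I := Complex.mk_eq_add_mul_I p q
  refine Prod.ext ?_ ?_
  · rw [hmk]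
    push_cast
    obtain ⟨f, hf⟩ : ∃ f : ℂ, f = a * c + Complex.I * (b * d) := ⟨_, rfl⟩
    obtain ⟨g, hg⟩ : ∃ g : ℂ, g = b * c - Complex.I * (a * d) := ⟨_, rfl⟩
    rw [← hf, ← hg]
    have e1 : f ^ 2 + g ^ 2 = a ^ 2 + b ^ 2 := by
      rw [hf, hg]
      linear_combination (b ^ 2 * d ^ 2 + a ^ 2 * d ^ 2 : ℂ) * Complex.I_sq + (a ^ 2 + b ^ 2 : ℂ) * px'
    have e2 : f * g = a * b * (c ^ 2 + d ^ 2) - Complex.I * c * d := by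
      rw [hf, hg]
      linear_combination (-(a * b * d ^ 2) : ℂ) * Complex.I_sq - (Complex.I * c * d) * pt'
    linear_combination (-(4 * y * u * f ^ 2 + 4 * y * conj u * u ^ 2 * g ^ 2 + 2 * u * (f * g))) *
      Complex.I_sq + (4 * y * u * g ^ 2) * hu + (4 * y * u) * e1 + 2 * u * e2
  · simp only [map_mul, map_sub, map_add, Complex.conj_I, Complex.conj_ofReal]
    have : -(2 * (y : ℂ) * Complex.I * (conj u * (u * (b * c - Complex.I * (a * d))) *
        (a * c + -Complex.I * (b * d)) + u * (a * c + Complex.I * (b * d)) *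
        (conj u * (b * c - -Complex.I * (a * d))))) - Complex.I / 2 * ((a * c + Complex.I * (b * d)) *
        (a * c + -Complex.I * (b * d)) + u * (b * c - Complex.I * (a * d)) *
        (conj u * (b * c - -Complex.I * (a * d)))) =
        ((-(4 * y * (a * b)) - 1 / 2 * ((a ^ 2 + b ^ 2) * (c ^ 2 + d ^ 2)) : ℝ) : ℂ) * Complex.I := by
      push_cast
      have e : u * (b * c - Complex.I * (a * d)) * (conj u * (b * c - -Complex.I * (a * d))) =
          (b ^ 2 * c ^ 2 + a ^ 2 * d ^ 2 : ℂ) := by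
        linear_combination ((b * c - Complex.I * (a * d)) * (b * c + Complex.I * (a * d)) : ℂ) * hu -
          (a ^ 2 * d ^ 2 : ℂ) * Complex.I_sq
      rw [e]
      linear_combination (-(4 * y * Complex.I * (a * b * c ^ 2 + a * b * d ^ 2 * Complex.I ^ 2)) : ℂ) * hu +
        (Complex.I / 2 * b ^ 2 * d ^ 2 - 4 * y * Complex.I * (a * b * d ^ 2) : ℂ) * Complex.I_sq -
        (4 * y * Complex.I * (a * b) : ℂ) * px'
    rw [this, Complex.mul_I_im, Complex.ofReal_re]
    ring

theorem cmcSurface_cylinderFrame_eq_lorentzBoost (φ t : ℝ) (z : ℂ) :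
    cmcSurface (cylinderFrame φ t) 1 z = lorentzBoost φ t (cmcSurface (cylinderFrame φ 0) 1 z) := by
  have hu := exp_mul_I_mul_conj φ
  rw [cmcSurface_cylinderFrame, cmcSurface_cylinderFrame, lorentzBoost]
  simp only [Real.cosh_zero, Real.sinh_zero]
  generalize (Complex.exp (-(φ * Complex.I)) * z).re = x
  generalize (Complex.exp (-(φ * Complex.I)) * z).im = y
  generalize Complex.exp (φ * Complex.I) = u at *
  have e : (conj u * (u * (⟨4 * 1 * y + 0 * Real.cosh (4 * x), -Real.sinh (4 * x)⟩ : ℂ))).re = 4 * y := by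
    rw [← mul_assoc, mul_comm (conj u), hu, one_mul]
    ring
  simp only [e]
  refine Prod.ext ?_ ?_
  · simp only [Complex.mk_eq_add_mul_I]
    push_cast
    ring
  · simp only
    ring

/-- The height of the surface in `Nil₃` given by `cylinderFrame`. -/
theorem exists_nilSurface_cylinderFrame_snd {U : Set ℂ} (hU : IsOpen U) (hUc : IsPreconnected U)
    (φ t : ℝ) : ∃ k : ℝ, ∀ z ∈ U, (nilSurface (cylinderFrame φ t) 1 z).2 =
      2 * Real.sinh t * (Complex.exp (-(φ * Complex.I)) * z).re -
        2 * Real.cosh t * ((Complex.exp (-(φ * Complex.I)) * z).im *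
          Real.sinh (4 * (Complex.exp (-(φ * Complex.I)) * z).re)) + k := by
  have hF := isExtendedFrame_cylinderFrame U φ t
  have hu := exp_mul_I_mul_conj φ
  set w := Complex.exp (-(φ * Complex.I)) with hw
  let X : ℂ →L[ℝ] ℝ := Complex.reCLM.comp (w • ContinuousLinearMap.id ℝ ℂ)
  let Y : ℂ →L[ℝ] ℝ := Complex.imCLM.comp (w • ContinuousLinearMap.id ℝ ℂ)
  have hX (z : ℂ) : HasFDerivAt (fun z => (w * z).re) X z := X.hasFDerivAt
  have hY (z : ℂ) : HasFDerivAt (fun z => (w * z).im) Y z := Y.hasFDerivAt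
  have hXI (v : ℂ) : X (Complex.I * v) = -Y v := by simp [X, Y]; ring
  have hYI (v : ℂ) : Y (Complex.I * v) = X v := by simp [X, Y]; ring
  have hS (z : ℂ) := ((hX z).const_mul 4).sinh
  have hC (z : ℂ) := ((hX z).const_mul 4).cosh
  -- This is a primitive of the height differential determined by the explicit surface in 𝕃₃.
  have hheight (z : ℂ) := ((hX z).const_mul (2 * Real.sinh t)).sub
    (((hY z).mul (hS z)).const_mul (2 * Real.cosh t))
  obtain ⟨k, hk⟩ := hU.exists_eq_add_of_fderiv_eq (𝕜 := ℝ) hUc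
    (f := fun ζ => (nilSurface (cylinderFrame φ t) 1 ζ).2)
    (fun z hz => (hF.fderiv_nilSurface_snd hU hz).2.2.1.differentiableWithinAt)
    (fun z hz => (hheight z).differentiableAt.differentiableWithinAt) (fun z hz => by
      obtain ⟨-, -, -, D⟩ := hF.fderiv_nilSurface_snd hU hz
      have h1 := ((Complex.ofRealCLM.hasFDerivAt.comp z (((hY z).const_mul (4 * Real.cosh t)).add
        ((hC z).const_mul (Real.sinh t)))).add ((Complex.ofRealCLM.hasFDerivAt.comp z
          (hS z).neg).mul_const Complex.I)).const_mul (Complex.exp (φ * Complex.I))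
      have h1' := h1.congr_of_eventuallyEq (f₁ := fun ζ => (cmcSurface (cylinderFrame φ t) 1 ζ).1)
        (Filter.Eventually.of_forall fun ζ => by
          simp only [cmcSurface_cylinderFrame, Complex.mk_eq_add_mul_I]
          rfl)
      have h2 := ((hY z).const_mul (4 * Real.sinh t)).add ((hC z).const_mul (Real.cosh t))
      have h2' := h2.congr_of_eventuallyEq (f₁ := fun ζ => (cmcSurface (cylinderFrame φ t) 1 ζ).2)
        (Filter.Eventually.of_forall fun ζ => by
          simp only [cmcSurface_cylinderFrame]
          rfl)
      refine ContinuousLinearMap.ext fun v => ?_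
      rw [D, h1'.fderiv, h2'.fderiv, (hheight z).fderiv, cmcSurface_cylinderFrame]
      have cs := Real.cosh_sq_sub_sinh_sq (4 * (w * z).re)
      simp only [_root_.add_apply, _root_.sub_apply, _root_.smul_apply, _root_.neg_apply,
        ContinuousLinearMap.comp_apply, smul_eq_mul, hXI, hYI, map_mul, Complex.ofRealCLM_apply,
        Complex.mk_eq_add_mul_I, map_add, Complex.conj_I, Complex.conj_ofReal]
      generalize X v = p
      generalize Y v = q
      have e : ∀ A B C D : ℝ, (conj (Complex.exp (φ * Complex.I)) * ((A : ℂ) + B * -Complex.I) *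
          (Complex.exp (φ * Complex.I) * ((C : ℂ) + (D * Complex.I)))).im = A * D - B * C := by
        intro A B C D
        have : conj (Complex.exp (φ * Complex.I)) * ((A : ℂ) + B * -Complex.I) *
          (Complex.exp (φ * Complex.I) * ((C : ℂ) + (D * Complex.I))) =
          ((A * C + B * D : ℝ) : ℂ) + ((A * D - B * C : ℝ) : ℂ) * Complex.I := by
          push_cast
          linear_combination (((A : ℂ) + B * -Complex.I) * ((C : ℂ) + (D * Complex.I))) * hu -
            (B * D : ℂ) * Complex.I_sq
        rw [this]
        simp
      simp only [mul_comm Complex.I]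
      rw [← Complex.ofReal_add (4 * Real.cosh t * q), e, ← hw]
      linear_combination (-2 * Real.sinh t * p) * cs)
  exact ⟨k, fun z hz => hk hz⟩

/-! ### Non-congruence of the images -/

/-- Both sides are real analytic, so the identity would extend from U to the whole plane. There it
can be restricted to the curve on which the coordinate along e^{iφ} vanishes, leaving a relation in
one variable between x and hyperbolic functions of 4x. -/
theorem not_forall_quadratic {U : Set ℂ} (hU : IsOpen U) (hne : U.Nonempty) {w : ℂ} (hw : w ≠ 0) {t : ℝ}
    (ht : t ≠ 0) (a b c d e f : ℝ) :
    ¬ ∀ z ∈ U, 2 * Real.sinh t * (w * z).re - 2 * Real.cosh t * ((w * z).im * Real.sinh (4 * (w * z).re)) =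
      a * (4 * Real.cosh t * (w * z).im + Real.sinh t * Real.cosh (4 * (w * z).re)) ^ 2 +
      b * (4 * Real.cosh t * (w * z).im + Real.sinh t * Real.cosh (4 * (w * z).re)) *
        Real.sinh (4 * (w * z).re) + c * Real.sinh (4 * (w * z).re) ^ 2 +
      d * (4 * Real.cosh t * (w * z).im + Real.sinh t * Real.cosh (4 * (w * z).re)) +
      e * Real.sinh (4 * (w * z).re) + f := by
  intro h
  have hx : ContDiff ℝ ω (fun z : ℂ => (w * z).re) :=
    Complex.reCLM.contDiff.comp (contDiff_const.mul contDiff_id)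
  have hy : ContDiff ℝ ω (fun z : ℂ => (w * z).im) :=
    Complex.imCLM.contDiff.comp (contDiff_const.mul contDiff_id)
  obtain ⟨z₀, hz₀⟩ := hne
  have hall := AnalyticOnNhd.eqOn_of_preconnected_of_eventuallyEq (𝕜 := ℝ)
    (contDiff_omega_iff_analyticOnNhd.mp (by fun_prop)) (contDiff_omega_iff_analyticOnNhd.mp (by fun_prop))
    isPreconnected_univ (mem_univ z₀) (Filter.eventually_of_mem (hU.mem_nhds hz₀) h)
  have hs : Real.sinh t ≠ 0 := by simpa using ht
  have hc : Real.cosh t ≠ 0 := (Real.cosh_pos t).ne'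
  have key (x : ℝ) : 2 * Real.sinh t * x + Real.sinh t / 2 * (Real.cosh (4 * x) * Real.sinh (4 * x)) =
      c * Real.sinh (4 * x) ^ 2 + e * Real.sinh (4 * x) + f := by
    have h1 := hall (mem_univ (w⁻¹ * ⟨x, -(Real.sinh t * Real.cosh (4 * x)) / (4 * Real.cosh t)⟩))
    simp only [mul_inv_cancel_left₀ hw] at h1
    have h2 : 4 * Real.cosh t * (-(Real.sinh t * Real.cosh (4 * x)) / (4 * Real.cosh t)) =
      -(Real.sinh t * Real.cosh (4 * x)) := by field_simp
    rw [h2] at h1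
    linear_combination h1 + Real.sinh (4 * x) / 2 * h2
  -- The odd part eliminates the coefficients c and f.
  have odd (r : ℝ) : r + Real.cosh r * Real.sinh r = 2 * e / Real.sinh t * Real.sinh r := by
    have h1 := key (r / 4)
    have h2 := key (-(r / 4))
    have e1 : 4 * (r / 4) = r := by ring
    have e2 : 4 * -(r / 4) = -r := by ring
    rw [e1] at h1
    rw [e2, Real.sinh_neg, Real.cosh_neg] at h2
    field_simp
    linear_combination h1 - h2
  set κ := 2 * e / Real.sinh t
  have lt (r : ℝ) (hr : 0 < r) : Real.cosh r < κ := by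
    have h1 := odd r
    have h2 : 0 < Real.sinh r := Real.sinh_pos_iff.mpr hr
    by_contra! h3
    nlinarith
  -- A bound cosh r < κ for all r > 0 is absurd: r = 1 gives κ > 0, and r = κ gives cosh κ < κ ≤
  -- sinh κ.
  have h1 := lt 1 one_pos
  have h2 : 0 < κ := (Real.cosh_pos 1).trans h1
  have h3 := lt κ h2
  have h4 := Real.sinh_lt_cosh κ
  have h5 := Real.self_le_sinh_iff.mpr h2.le
  linarith

/-- On the untilted image the height is, up to a constant, ½ Re(ūζ) Im(ūζ) with u = e^{iφ}. An
isometry is affine and invertible on the base, so on the tilted image the height would again be a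
quadratic polynomial in ζ. -/
theorem not_congruent_images_cylinderFrame {U : Set ℂ} (hU : IsOpen U) (hUc : IsConnected U) (φ : ℝ) {t : ℝ}
    (ht : t ≠ 0) : ¬ ∃ g : ℂ × ℝ → ℂ × ℝ, IsNilIsometry g ∧
      g '' (nilSurface (cylinderFrame φ 0) 1 '' U) = nilSurface (cylinderFrame φ t) 1 '' U := by
  rintro ⟨g, hg, himg⟩
  obtain ⟨L, c, ε, r, m, hinj, hL⟩ := hg.exists_affine
  obtain ⟨k, hk⟩ := exists_nilSurface_cylinderFrame_snd hU hUc.isPreconnected φ 0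
  obtain ⟨k', hk'⟩ := exists_nilSurface_cylinderFrame_snd hU hUc.isPreconnected φ t
  obtain ⟨M, hM⟩ := LinearMap.exists_leftInverse_of_injective (L : ℂ →ₗ[ℝ] ℂ) (LinearMap.ker_eq_bot.mpr hinj)
  have hM (x : ℂ) : M (L x) = x := DFunLike.congr_fun hM x
  have hlin {E : Type} [AddCommGroup E] [Module ℝ E] (T : ℂ →ₗ[ℝ] E) (v : ℂ) :
      T v = v.re • T 1 + v.im • T Complex.I := by
    rw [← map_smul, ← map_smul, ← map_add]
    congr 1
    simp [Complex.re_add_im]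
  have hu := exp_mul_I_mul_conj φ
  set w := Complex.exp (-(φ * Complex.I)) with hw
  set u := Complex.exp (φ * Complex.I) with hu'
  -- N and v describe the inverse base map in coordinates rotated by u, in which the untilted point
  -- is X' - iS' and the tilted one X - iS.
  let N : ℂ →ₗ[ℝ] ℂ := (LinearMap.mulLeft ℝ (conj u)).comp (M.comp (LinearMap.mulLeft ℝ u))
  have hN (x : ℂ) : N x = conj u * M (u * x) := rfl
  let m' : ℂ →ₗ[ℝ] ℝ := (m : ℂ →ₗ[ℝ] ℝ).comp (LinearMap.mulLeft ℝ u)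
  have hm' (x : ℂ) : m (u * x) = m' x := rfl
  obtain ⟨v, hv⟩ : ∃ v, v = -(conj u * M c) := ⟨_, rfl⟩
  obtain ⟨p₁, hp₁⟩ : ∃ p, p = (N 1).re := ⟨_, rfl⟩
  obtain ⟨p₂, hp₂⟩ : ∃ p, p = (N Complex.I).re := ⟨_, rfl⟩
  obtain ⟨q₁, hq₁⟩ : ∃ p, p = (N 1).im := ⟨_, rfl⟩
  obtain ⟨q₂, hq₂⟩ : ∃ p, p = (N Complex.I).im := ⟨_, rfl⟩
  obtain ⟨n₁, hn₁⟩ : ∃ p, p = m' 1 := ⟨_, rfl⟩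
  obtain ⟨n₂, hn₂⟩ : ∃ p, p = m' Complex.I := ⟨_, rfl⟩
  -- The coefficients come from expanding ε(k - X'S'/2) plus the affine terms, with X' = p₁X - p₂S +
  -- Re v and -S' = q₁X - q₂S + Im v.
  refine not_forall_quadratic hU hUc.nonempty (Complex.exp_ne_zero _ : w ≠ 0) ht
    (ε / 2 * p₁ * q₁) (-(ε / 2 * (p₁ * q₂ + p₂ * q₁))) (ε / 2 * p₂ * q₂)
    (ε / 2 * (p₁ * v.im + q₁ * v.re) + n₁ * p₁ + n₂ * q₁)
    (-(ε / 2 * (p₂ * v.im + q₂ * v.re) + n₁ * p₂ + n₂ * q₂))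
    (ε / 2 * v.re * v.im + ε * k + n₁ * v.re + n₂ * v.im + r - k') fun z hz => ?_
  -- Only the inclusion of the tilted image in the moved untilted one is used; the parameter z' need
  -- not be related to z by any given map.
  have hmem : nilSurface (cylinderFrame φ t) 1 z ∈ g '' (nilSurface (cylinderFrame φ 0) 1 '' U) := by
    rw [himg]; exact mem_image_of_mem _ hz
  obtain ⟨_, ⟨z', hz', rfl⟩, hgz⟩ := hmem
  rw [hL] at hgz
  have h1 := congrArg Prod.fst hgz
  have h2 := congrArg Prod.snd hgz
  simp only [hk z' hz', hk' z hz, IsExtendedFrame.nilSurface_fst, cmcSurface_cylinderFrame, ← hw, ← hu',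
    Real.cosh_zero, Real.sinh_zero, hm'] at h1 h2
  generalize (w * z).re = x at *
  generalize (w * z).im = y at *
  generalize (w * z').re = x' at *
  generalize (w * z').im = y' at *
  generalize hX : 4 * Real.cosh t * y + Real.sinh t * Real.cosh (4 * x) = X at *
  generalize Real.sinh (4 * x) = S at *
  generalize hX' : 4 * 1 * y' + 0 * Real.cosh (4 * x') = X' at *
  generalize Real.sinh (4 * x') = S' at *
  have h3 : (⟨X', -S'⟩ : ℂ) = N ⟨X, -S⟩ + v := by
    rw [hN, ← h1, map_add, hM, hv]
    linear_combination (-(⟨X', -S'⟩ : ℂ)) * hu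
  rw [hlin N] at h3
  rw [hlin m'] at h2
  have h4 := congrArg Complex.re h3
  have h5 := congrArg Complex.im h3
  simp only [Complex.add_re, Complex.add_im, Complex.real_smul, Complex.re_ofReal_mul, Complex.im_ofReal_mul,
    smul_eq_mul, ← hp₁, ← hp₂, ← hq₁, ← hq₂, ← hn₁, ← hn₂] at h4 h5 h2
  linear_combination -h2 - (ε / 2 * S') * hX' + (ε / 2 * -S' + n₁) * h4 +
    (ε / 2 * (X * p₁ + -S * p₂ + v.re) + n₂) * h5

theorem mainTheorem5 (U : Set ℂ) (hU : IsOpen U) (hUc : IsConnected U) :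
    (∀ F F' : Circle → ℂ → Matrix (Fin 2) (Fin 2) ℂ,
      IsExtendedFrame U F → IsExtendedFrame U F' →
        -- rotations about the timelike axis
        (∀ φ : ℝ,
          (∀ z ∈ U, cmcSurface F' 1 z = axisRotation φ (cmcSurface F 1 z)) →
          ∃ a : ℂ × ℝ, ∀ z ∈ U,
            nilSurface F' 1 z = nilMul a (axisRotation φ (nilSurface F 1 z))) ∧
        -- translations
        (∀ b : ℂ × ℝ,
          (∀ z ∈ U, cmcSurface F' 1 z = cmcSurface F 1 z + b) →
          ∃ a : ℂ × ℝ, ∀ z ∈ U, nilSurface F' 1 z = nilMul a (nilSurface F 1 z)) ∧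
        -- nontrivial boosts: the two maps into the Heisenberg group are never congruent
        (∀ φ t : ℝ, t ≠ 0 →
          (∀ z ∈ U, cmcSurface F' 1 z = lorentzBoost φ t (cmcSurface F 1 z)) →
          ¬ ∃ g : ℂ × ℝ → ℂ × ℝ, IsNilIsometry g ∧
            ∀ z ∈ U, nilSurface F' 1 z = g (nilSurface F 1 z))) ∧
    -- for every nontrivial boost, in general not even the images are congruent
    (∀ φ t : ℝ, t ≠ 0 →
      ∃ F F' : Circle → ℂ → Matrix (Fin 2) (Fin 2) ℂ,
        IsExtendedFrame U F ∧ IsExtendedFrame U F' ∧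
        (∀ z ∈ U, cmcSurface F' 1 z = lorentzBoost φ t (cmcSurface F 1 z)) ∧
        ¬ ∃ g : ℂ × ℝ → ℂ × ℝ, IsNilIsometry g ∧
          g '' (nilSurface F 1 '' U) = nilSurface F' 1 '' U) :=
  ⟨fun _ _ hF hF' => ⟨fun φ h => hF.nilSurface_of_axisRotation hF' hU hUc.isPreconnected φ h,
      fun b h => hF.nilSurface_of_translation hF' hU hUc.isPreconnected b h,
      fun _ _ ht h => hF.not_congruent_of_lorentzBoost hU hUc.nonempty ht h⟩,
    fun φ t ht => ⟨cylinderFrame φ 0, cylinderFrame φ t, isExtendedFrame_cylinderFrame U φ 0,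
      isExtendedFrame_cylinderFrame U φ t, fun z _ => cmcSurface_cylinderFrame_eq_lorentzBoost φ t z,
      not_congruent_images_cylinderFrame hU hUc φ ht⟩⟩
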